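/- Let $\mathbf k$ be a field of characteristic zero. Operads are symmetric unital operads in $\mathbf k$-vector spaces, with right $\Sigma_n$-actions. Let $\mathcal P$ be a quadratic (for instance, quadratic Koszul) operad, that is, $\mathcal P\cong\Gamma(E)/(R)$ for a $\Sigma_2$-module $E$ in arity two and $R\subset\Gamma(E)(3)$, with $\mathcal P(2)$ finite dimensional. Let $\mathcal P^!=\Gamma(\mathcal P(2)^\#\otimes \mathrm{sgn}_2)/(R^\perp)$ be its quadratic dual, where $R^\perp$ is the annihilator of the kernel of $\Gamma(\mathcal P(2))(3)\to\mathcal P(3)$. **The complex $(\mathcal P\otimes\mathcal P^!)^\Sigma_*$.** For an operad $\mathcal T$ and $m\ge1$ put $\mathcal T^\Sigma_{m-1}=(\mathcal T(m)\otimes \mathrm{sgn}_m)^{\Sigma_m}$. The bracket of $f\in\mathcal T(m)$ and $g\in\mathcal T(n)$ is $[f,g]=f\circ g-(-1)^{(m-1)(n-1)}g\circ f$ with $f\circ g=\sum_{1\le i\le m}(-1)^{(n-1)(i-1)}f\circ_i g$; it induces a bracket on $\mathcal T^\Sigma_*$ by restricting to invariants and then averaging over the group (with signs). Take for $\mathcal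 T$ the Hadamard product $(\mathcal P\otimes\mathcal P^!)(n)=\mathcal P(n)\otimes\mathcal P^!(n)$. The canonical element $\chi\in(\mathcal P\otimes\mathcal P^!)^\Sigma_1$ corresponds to $\mathrm{id}_{\mathcal P(2)}$ under $\mathcal P(2)\otimes\mathcal P^!(2)\cong\mathcal P(2)\otimes\mathcal P(2)^\#\cong \mathrm{Lin}(\mathcal P(2),\mathcal P(2))$, and $\delta^\Sigma_\chi t=[\chi,t]$. **The complex $(\mathcal B^*_{\mathcal P}(0),\delta_{\mathcal P})$.** For a $\mathcal P$-algebra $\alpha:\mathcal P\to\mathcal End_A$ on a vector space $A$ let $$C^{m-1}_{\mathcal P}(A;A)=\bigl(\mathrm{Lin}(A^{\otimes m},A)\otimes\mathcal P^!(m)\otimes\mathrm{sgn}_m\bigr)^{\Sigma_m},\quad m\ge1.$$ Its differential is $d_{\mathcal P}f=D\star f-(-1)^{|f|}f\star D$. Here $D\in C^1_{\mathcal P}(A;A)$ is the element corresponding to $\alpha:\mathcal P(2)\to\mathrm{Lin}(A^{\otimes2},A)$, and, for $f$ of arity $m$ and $g$ of arity $n$, $f\star g=\frac1{n!\,(m-1)!}\sum_{\sigma\in\Sigma_{m+n-1}}\mathrm{sgn}(\sigma)\,(f\circ_1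 g)\sigma$ (the sum over unshuffles, i.e. the pre-Lie product of coderivations of the cofree nilpotent $\mathcal P^!$-coalgebra on $\downarrow\! A$). A natural operation without inputs, of degree $d$, is the family $U=(U_A)_A$, indexed by all $\mathcal P$-algebras $A$, of elements $U_A=\mathrm{Aver}(T_A\otimes\varphi)\in C^d_{\mathcal P}(A;A)$. Here $T$ is a rooted tree with $d+1$ labelled legs and with vertices, all of arity at least two, decorated by elements of $\mathcal P$; $T_A$ is the composition along $T$ in $\mathcal End_A$; and $\varphi\in\mathcal P^!(d+1)$. Let $\mathcal B^d_{\mathcal P}(0)$ be the span of these families and $(\delta_{\mathcal P}U)_A=d_{\mathcal P}(U_A)$. **Proposition.** One has $[\chi,\chi]=0$ and $(\delta^\Sigma_\chi)^2=0$; $\delta_{\mathcal P}$ maps $\mathcal B^d_{\mathcal P}(0)$ to $\mathcal B^{d+1}_{\mathcal P}(0)$ and squares to zero there; and there is a natural isomorphism of cochain complexes $$(\mathcal B^*_{\mathcal P}(0),\delta_{\mathcal P})\;\cong\;\bigl((\mathcal P\otimes\mathcal P^!)^\Sigma_*,\delta^\Sigma_\chi\bigr).$$ In degree $d$ its inverse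 sends $t$ to the family whose value at $A$ is $\frac{(d+1)!}{2^d}\,(\alpha\otimes\mathrm{id})(t)$. It is natural with respect to isomorphisms $f:\mathcal P\to\mathcal Q$ of quadratic operads and the induced (contragredient) morphisms $\mathcal P^!\to\mathcal Q^!$. -/

import Mathlib

universe u

open scoped TensorProduct

namespace NatOp

open Equiv (Perm)

/-! ## Operads -/

/-- The input of `p ∘ᵢ q` (with `p` of arity `m`, `q` of arity `n`) that is the `j`-th input
of `q`. All positions are counted from `0`. -/
def innerSlot {m n l : ℕ} (h : m + n = l + 1) (i : Fin m) (j : Fin n) : Fin l :=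
  ⟨i.1 + j.1, by have := i.2; have := j.2; omega⟩

/-- The input of `p ∘ᵢ q` (with `p` of arity `m`, `q` of arity `n`) that is the `a`-th input
of `p`, where `a ≠ i`. -/
def outerSlot {m n l : ℕ} (h : m + n = l + 1) (i a : Fin m) (ha : a ≠ i) : Fin l :=
  ⟨if a.1 < i.1 then a.1 else a.1 + n - 1, by
    have := i.2; have := a.2; have : a.1 ≠ i.1 := fun e => ha (Fin.ext e)
    split_ifs <;> omega⟩

/-- A (symmetric, unital) operad in the category of vector spaces over `k`, given by the
`∘ᵢ`-operations. The arity of `p ∘ᵢ q` is `m + n - 1`, encoded by an equation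
`m + n = l + 1`. The symmetric groups act on the right: `act σ p` is `p σ`. -/
structure Operad (k : Type u) [Field k] where
  obj : ℕ → Type u
  [addCommGroup : ∀ n, AddCommGroup (obj n)]
  [module : ∀ n, Module k (obj n)]
  /-- the operadic unit -/
  one : obj 1
  /-- the right action, `act σ p = p σ` -/
  act : ∀ {n : ℕ}, Perm (Fin n) → obj n →ₗ[k] obj n
  /-- the operation `p ∘ᵢ q` -/
  comp : ∀ {m n l : ℕ}, m + n = l + 1 → Fin m → obj m →ₗ[k] obj n →ₗ[k] obj l
  act_one : ∀ {n : ℕ} (p : obj n), act 1 p = p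
  act_mul : ∀ {n : ℕ} (σ τ : Perm (Fin n)) (p : obj n), act (σ * τ) p = act τ (act σ p)
  one_comp : ∀ {n : ℕ} (h : 1 + n = n + 1) (q : obj n), comp h 0 one q = q
  comp_one : ∀ {m : ℕ} (h : m + 1 = m + 1) (i : Fin m) (p : obj m), comp h i p one = p
  /-- `(p ∘ᵢ q) ∘ x = p ∘ᵢ (q ∘ⱼ x)` where `x` is inserted into the `j`-th input of `q` -/
  comp_comp_inner : ∀ {m n r l s t : ℕ} (h₁ : m + n = l + 1) (h₂ : l + r = t + 1)
    (h₃ : n + r = s + 1) (h₄ : m + s = t + 1) (i : Fin m) (j : Fin n)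
    (p : obj m) (q : obj n) (x : obj r),
    comp h₂ (innerSlot h₁ i j) (comp h₁ i p q) x = comp h₄ i p (comp h₃ j q x)
  /-- insertions into two different inputs of `p` commute -/
  comp_comp_outer : ∀ {m n r l s t : ℕ} (h₁ : m + n = l + 1) (h₂ : l + r = t + 1)
    (h₃ : m + r = s + 1) (h₄ : s + n = t + 1) (i a : Fin m) (ha : a ≠ i)
    (p : obj m) (q : obj n) (x : obj r),
    comp h₂ (outerSlot h₁ i a ha) (comp h₁ i p q) x =
      comp h₄ (outerSlot h₃ a i ha.symm) (comp h₃ a p x) q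
  /-- equivariance: `pσ ∘ᵢ qτ = (p ∘_{σ(i)} q) ρ`, where `ρ` is the permutation that acts
  as `σ` on the block of `n` inputs and on the remaining inputs, and as `τ` inside the block -/
  comp_act : ∀ {m n l : ℕ} (h : m + n = l + 1) (i : Fin m) (σ : Perm (Fin m))
    (τ : Perm (Fin n)) (ρ : Perm (Fin l)),
    (∀ j, ρ (innerSlot h i j) = innerSlot h (σ i) (τ j)) →
    (∀ a (ha : a ≠ i), ρ (outerSlot h i a ha) =
      outerSlot h (σ i) (σ a) (fun e => ha (σ.injective e))) →
    ∀ (p : obj m) (q : obj n), comp h i (act σ p) (act τ q) = act ρ (comp h (σ i) p q)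

attribute [instance] Operad.addCommGroup Operad.module

variable {k : Type u} [Field k]

/-- Morphisms of operads. -/
structure OperadHom (P Q : Operad k) where
  map : ∀ n, P.obj n →ₗ[k] Q.obj n
  map_one : map 1 P.one = Q.one
  map_act : ∀ {n : ℕ} (σ : Perm (Fin n)) (p : P.obj n), map n (P.act σ p) = Q.act σ (map n p)
  map_comp : ∀ {m n l : ℕ} (h : m + n = l + 1) (i : Fin m) (p : P.obj m) (q : P.obj n),
    map l (P.comp h i p q) = Q.comp h i (map m p) (map n q)

/-- The composition `g ∘ f` of morphisms of operads. -/
def OperadHom.comp {P Q S : Operad k} (g : OperadHom Q S) (f : OperadHom P Q) :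
    OperadHom P S where
  map n := g.map n ∘ₗ f.map n
  map_one := by simp [f.map_one, g.map_one]
  map_act σ p := by simp [f.map_act, g.map_act]
  map_comp h i p q := by simp [f.map_comp, g.map_comp]

/-- Isomorphisms of operads. -/
structure OperadIso (P Q : Operad k) where
  hom : OperadHom P Q
  inv : OperadHom Q P
  inv_hom : ∀ n (p : P.obj n), inv.map n (hom.map n p) = p
  hom_inv : ∀ n (q : Q.obj n), hom.map n (inv.map n q) = q

/-! ## The endomorphism operad -/

lemma perm_inv_apply {n : ℕ} (σ : Perm (Fin n)) (a : Fin n) : σ⁻¹ (σ a) = a :=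
  σ.symm_apply_apply a

lemma slot_cases {m n l : ℕ} (h : m + n = l + 1) (i : Fin m) (x : Fin l) :
    (∃ j, x = innerSlot h i j) ∨ ∃ a, ∃ ha : a ≠ i, x = outerSlot h i a ha := by
  have := x.2
  have := i.2
  by_cases h1 : x.1 < i.1
  · refine Or.inr ⟨⟨x.1, by omega⟩, fun e => ?_, ?_⟩
    · have := congrArg Fin.val e; simp at this; omega
    · ext; simp [outerSlot, h1]
  · by_cases h2 : x.1 < i.1 + n
    · refine Or.inl ⟨⟨x.1 - i.1, by omega⟩, ?_⟩
      ext; simp [innerSlot]; omega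
    · refine Or.inr ⟨⟨x.1 + 1 - n, by omega⟩, fun e => ?_, ?_⟩
      · have := congrArg Fin.val e; simp at this; omega
      · ext
        have : ¬ (x.1 + 1 - n < i.1) := by omega
        simp [outerSlot, this]; omega

lemma innerSlot_injective {m n l : ℕ} (h : m + n = l + 1) (i : Fin m) (j j' : Fin n) :
    innerSlot h i j = innerSlot h i j' ↔ j = j' := by
  simp [innerSlot, Fin.ext_iff]

lemma outerSlot_injective {m n l : ℕ} (h : m + n = l + 1) (i a a' : Fin m) (ha : a ≠ i)
    (ha' : a' ≠ i) : outerSlot h i a ha = outerSlot h i a' ha' ↔ a = a' := by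
  have h1 : a.1 ≠ i.1 := fun e => ha (Fin.ext e)
  have h2 : a'.1 ≠ i.1 := fun e => ha' (Fin.ext e)
  simp only [outerSlot, Fin.ext_iff]
  split_ifs <;> omega

lemma innerSlot_ne_outerSlot {m n l : ℕ} (h : m + n = l + 1) (i a : Fin m) (ha : a ≠ i)
    (j : Fin n) : innerSlot h i j ≠ outerSlot h i a ha := by
  have h1 : a.1 ≠ i.1 := fun e => ha (Fin.ext e)
  have := j.2
  simp only [innerSlot, outerSlot, ne_eq, Fin.ext_iff]
  split_ifs <;> omega

section End

variable {A : Type u}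

/-- The arguments of `f` in `(f ∘ᵢ g)(v)`. -/
def plug {m n l : ℕ} (h : m + n = l + 1) (i : Fin m)
    (g : (Fin n → A) → A) (v : Fin l → A) : Fin m → A :=
  fun a => if ha : a = i then g (fun j => v (innerSlot h i j)) else v (outerSlot h i a ha)

lemma plug_self {m n l : ℕ} (h : m + n = l + 1) (i : Fin m)
    (g : (Fin n → A) → A) (v : Fin l → A) :
    plug h i g v i = g (fun j => v (innerSlot h i j)) := by simp [plug]

lemma plug_of_ne {m n l : ℕ} (h : m + n = l + 1) (i a : Fin m) (ha : a ≠ i)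
    (g : (Fin n → A) → A) (v : Fin l → A) :
    plug h i g v a = v (outerSlot h i a ha) := by simp [plug, ha]

lemma plug_update_inner {m n l : ℕ} (h : m + n = l + 1) (i : Fin m)
    (g : (Fin n → A) → A) (v : Fin l → A) (j : Fin n) (x : A) :
    plug h i g (Function.update v (innerSlot h i j) x) =
      Function.update (plug h i g v) i
        (g (Function.update (fun j => v (innerSlot h i j)) j x)) := by
  funext a
  by_cases ha : a = i
  · subst ha
    rw [plug_self, Function.update_self]
    congr 1
    funext j'
    by_cases hj : j' = j
    · subst hj; simp
    · rw [Function.update_of_ne hj, Function.update_of_ne]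
      rwa [ne_eq, innerSlot_injective]
  · rw [plug_of_ne h i a ha, Function.update_of_ne ha, plug_of_ne h i a ha,
      Function.update_of_ne]
    exact (innerSlot_ne_outerSlot h i a ha j).symm

lemma plug_update_outer {m n l : ℕ} (h : m + n = l + 1) (i : Fin m)
    (g : (Fin n → A) → A) (v : Fin l → A) (a : Fin m) (ha : a ≠ i) (x : A) :
    plug h i g (Function.update v (outerSlot h i a ha) x) =
      Function.update (plug h i g v) a x := by
  funext b
  by_cases hb : b = i
  · subst hb
    rw [plug_self, Function.update_of_ne (Ne.symm ha), plug_self]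
    congr 1
    funext j
    rw [Function.update_of_ne]
    exact innerSlot_ne_outerSlot h _ a ha j
  · rw [plug_of_ne h i b hb]
    by_cases hab : b = a
    · subst hab; simp
    · rw [Function.update_of_ne hab, Function.update_of_ne, plug_of_ne h i b hb]
      rwa [ne_eq, outerSlot_injective]

lemma plug_eq_update {m n l : ℕ} (h : m + n = l + 1) (i : Fin m)
    (g g' : (Fin n → A) → A) (v : Fin l → A) :
    plug h i g v = Function.update (plug h i g' v) i (g fun j => v (innerSlot h i j)) := by
  funext a
  by_cases ha : a = i
  · subst ha; simp [plug_self]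
  · rw [Function.update_of_ne ha, plug_of_ne h i a ha, plug_of_ne h i a ha]

variable [AddCommGroup A] [Module k A]

/-- `(f ∘ᵢ g)(v₁, …) = f(v₁, …, g(vᵢ, …), …)`. -/
def endCompAux {m n l : ℕ} (h : m + n = l + 1) (i : Fin m)
    (f : MultilinearMap k (fun _ : Fin m => A) A)
    (g : MultilinearMap k (fun _ : Fin n => A) A) :
    MultilinearMap k (fun _ : Fin l => A) A where
  toFun v := f (plug h i g v)
  map_update_add' {dec} v x a b := by
    rw [Subsingleton.elim dec (instDecidableEqFin l)]
    rcases slot_cases h i x with ⟨j, rfl⟩ | ⟨c, hc, rfl⟩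
    · simp only [plug_update_inner, MultilinearMap.map_update_add]
    · simp only [plug_update_outer, MultilinearMap.map_update_add]
  map_update_smul' {dec} v x a b := by
    rw [Subsingleton.elim dec (instDecidableEqFin l)]
    rcases slot_cases h i x with ⟨j, rfl⟩ | ⟨c, hc, rfl⟩
    · simp only [plug_update_inner, MultilinearMap.map_update_smul]
    · simp only [plug_update_outer, MultilinearMap.map_update_smul]

/-- `endCompAux` as a bilinear map. -/
def endComp {m n l : ℕ} (h : m + n = l + 1) (i : Fin m) :
    MultilinearMap k (fun _ : Fin m => A) A →ₗ[k]
      MultilinearMap k (fun _ : Fin n => A) A →ₗ[k] MultilinearMap k (fun _ : Fin l => A) A :=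
  LinearMap.mk₂ k (endCompAux h i)
    (fun _ _ _ => rfl) (fun _ _ _ => rfl)
    (fun f g g' => by
      ext v
      change f (plug h i (⇑(g + g')) v) = f (plug h i g v) + f (plug h i g' v)
      rw [plug_eq_update h i (⇑(g + g')) (fun _ => 0), plug_eq_update h i g (fun _ => 0),
        plug_eq_update h i g' (fun _ => 0), ← MultilinearMap.map_update_add]
      rfl)
    (fun c f g => by
      ext v
      change f (plug h i (⇑(c • g)) v) = c • f (plug h i g v)
      rw [plug_eq_update h i (⇑(c • g)) (fun _ => 0), plug_eq_update h i g (fun _ => 0),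
        ← MultilinearMap.map_update_smul]
      rfl)

lemma endComp_apply {m n l : ℕ} (h : m + n = l + 1) (i : Fin m)
    (f : MultilinearMap k (fun _ : Fin m => A) A)
    (g : MultilinearMap k (fun _ : Fin n => A) A) (v : Fin l → A) :
    endComp h i f g v = f (plug h i g v) := rfl

end End

lemma innerSlot_innerSlot {m n r l s t : ℕ} (h₁ : m + n = l + 1) (h₂ : l + r = t + 1)
    (h₃ : n + r = s + 1) (h₄ : m + s = t + 1) (i : Fin m) (j : Fin n) (c : Fin r) :
    innerSlot h₂ (innerSlot h₁ i j) c = innerSlot h₄ i (innerSlot h₃ j c) := by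
  ext; simp [innerSlot]; omega

lemma outerSlot_innerSlot {m n r l s t : ℕ} (h₁ : m + n = l + 1) (h₂ : l + r = t + 1)
    (h₃ : n + r = s + 1) (h₄ : m + s = t + 1) (i : Fin m) (j b : Fin n) (hb : b ≠ j)
    (hb' : innerSlot h₁ i b ≠ innerSlot h₁ i j) :
    outerSlot h₂ (innerSlot h₁ i j) (innerSlot h₁ i b) hb' =
      innerSlot h₄ i (outerSlot h₃ j b hb) := by
  have : b.1 ≠ j.1 := fun e => hb (Fin.ext e)
  ext
  by_cases hbj : b.1 < j.1
  · have : i.1 + b.1 < i.1 + j.1 := by omega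
    simp [innerSlot, outerSlot, hbj]
  · have : ¬ (i.1 + b.1 < i.1 + j.1) := by omega
    simp [innerSlot, outerSlot, hbj]
    omega

lemma outerSlot_outerSlot {m n r l s t : ℕ} (h₁ : m + n = l + 1) (h₂ : l + r = t + 1)
    (h₃ : n + r = s + 1) (h₄ : m + s = t + 1) (i a : Fin m) (ha : a ≠ i) (j : Fin n)
    (ha' : outerSlot h₁ i a ha ≠ innerSlot h₁ i j) :
    outerSlot h₂ (innerSlot h₁ i j) (outerSlot h₁ i a ha) ha' = outerSlot h₄ i a ha := by
  have : a.1 ≠ i.1 := fun e => ha (Fin.ext e)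
  have := j.2
  ext; simp only [innerSlot, outerSlot]
  (repeat' split) <;> omega

lemma outer_inner_comm {m n r l s t : ℕ} (h₁ : m + n = l + 1) (h₂ : l + r = t + 1)
    (h₃ : m + r = s + 1) (h₄ : s + n = t + 1) (i a : Fin m) (ha : a ≠ i) (c : Fin r)
    (hc : innerSlot h₃ a c ≠ outerSlot h₃ a i ha.symm) :
    innerSlot h₂ (outerSlot h₁ i a ha) c =
      outerSlot h₄ (outerSlot h₃ a i ha.symm) (innerSlot h₃ a c) hc := by
  have : a.1 ≠ i.1 := fun e => ha (Fin.ext e)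
  have := c.2; have := i.2; have := a.2
  ext; simp only [innerSlot, outerSlot]
  (repeat' split) <;> omega

lemma outer_outer_comm {m n r l s t : ℕ} (h₁ : m + n = l + 1) (h₂ : l + r = t + 1)
    (h₃ : m + r = s + 1) (h₄ : s + n = t + 1) (i a b : Fin m) (ha : a ≠ i) (hbi : b ≠ i)
    (hba : b ≠ a) (h5 : outerSlot h₁ i b hbi ≠ outerSlot h₁ i a ha)
    (h6 : outerSlot h₃ a b hba ≠ outerSlot h₃ a i ha.symm) :
    outerSlot h₂ (outerSlot h₁ i a ha) (outerSlot h₁ i b hbi) h5 =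
      outerSlot h₄ (outerSlot h₃ a i ha.symm) (outerSlot h₃ a b hba) h6 := by
  have : a.1 ≠ i.1 := fun e => ha (Fin.ext e)
  have : b.1 ≠ i.1 := fun e => hbi (Fin.ext e)
  have : b.1 ≠ a.1 := fun e => hba (Fin.ext e)
  have := i.2; have := a.2; have := b.2
  ext; simp only [outerSlot]
  (repeat' split) <;> omega

/-- The endomorphism operad `End_A(n) = Lin(A^{⊗ n}, A)` of a vector space `A`, with
`(f σ)(v₁, …, vₙ) = f(v_{σ⁻¹(1)}, …, v_{σ⁻¹(n)})`. -/
def endOperad (k : Type u) [Field k] (A : Type u) [AddCommGroup A] [Module k A] :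
    Operad k where
  obj n := MultilinearMap k (fun _ : Fin n => A) A
  one := MultilinearMap.ofSubsingleton k A A (0 : Fin 1) LinearMap.id
  act σ := (MultilinearMap.domDomCongrLinearEquiv k k A A σ⁻¹).toLinearMap
  comp h i := endComp h i
  act_one f := by ext v; rfl
  act_mul σ τ f := by
    ext v
    simp [MultilinearMap.domDomCongr]
  one_comp h q := by
    ext v
    rw [endComp_apply]
    change plug h 0 q v 0 = q v
    rw [plug_self]
    congr 1
    funext j
    congr 1
    ext; simp [innerSlot]
  comp_one h i p := by
    ext v
    rw [endComp_apply]
    congr 1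
    funext a
    by_cases ha : a = i
    · subst ha
      rw [plug_self]
      change v _ = v _
      congr 1
    · rw [plug_of_ne h i a ha]
      congr 1
      ext; simp [outerSlot]
  comp_comp_inner h₁ h₂ h₃ h₄ i j p q x := by
    ext v
    simp only [endComp_apply]
    congr 1
    funext a
    by_cases ha : a = i
    · subst ha
      rw [plug_self, plug_self, endComp_apply]
      congr 1
      funext b
      by_cases hb : b = j
      · subst hb
        rw [plug_self, plug_self]
        congr 1
        funext c
        rw [innerSlot_innerSlot h₁ h₂ h₃ h₄]
      · have hb' : innerSlot h₁ a b ≠ innerSlot h₁ a j := by rwa [ne_eq, innerSlot_injective]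
        rw [plug_of_ne _ _ b hb, plug_of_ne _ _ _ hb', outerSlot_innerSlot h₁ h₂ h₃ h₄ a j b hb]
    · have ha' := (innerSlot_ne_outerSlot h₁ i a ha j).symm
      rw [plug_of_ne _ _ a ha, plug_of_ne _ _ a ha, plug_of_ne _ _ _ ha',
        outerSlot_outerSlot h₁ h₂ h₃ h₄ i a ha j]
  comp_comp_outer h₁ h₂ h₃ h₄ i a ha p q x := by
    ext v
    simp only [endComp_apply]
    congr 1
    funext b
    by_cases hb : b = i
    · subst hb
      rw [plug_self, plug_of_ne _ _ b ha.symm, plug_self]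
      congr 1
      funext c
      have hc := innerSlot_ne_outerSlot h₁ b a ha c
      rw [plug_of_ne _ _ _ hc]
      congr 1
      exact (outer_inner_comm h₃ h₄ h₁ h₂ a b ha.symm c hc).symm
    · rw [plug_of_ne _ _ b hb]
      by_cases hba : b = a
      · subst hba
        rw [plug_self, plug_self]
        congr 1
        funext c
        have hc := innerSlot_ne_outerSlot h₃ b i ha.symm c
        rw [plug_of_ne _ _ _ hc]
        congr 1
        exact outer_inner_comm h₁ h₂ h₃ h₄ i b ha c hc
      · have h5 : outerSlot h₁ i b hb ≠ outerSlot h₁ i a ha := by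
          rwa [ne_eq, outerSlot_injective]
        have h6 : outerSlot h₃ a b hba ≠ outerSlot h₃ a i ha.symm := by
          rwa [ne_eq, outerSlot_injective]
        rw [plug_of_ne _ _ b hba, plug_of_ne _ _ _ h5, plug_of_ne _ _ _ h6]
        congr 1
        exact outer_outer_comm h₁ h₂ h₃ h₄ i a b ha hb hba h5 h6
  comp_act h i σ τ ρ h1 h2 p q := by
    ext v
    change p (fun a => plug h i (fun w => q fun b => w (τ⁻¹ b)) v (σ⁻¹ a)) =
      p (plug h (σ i) q fun x => v (ρ⁻¹ x))
    congr 1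
    funext a
    obtain ⟨a, rfl⟩ := σ.surjective a
    rw [perm_inv_apply]
    by_cases ha : a = i
    · subst ha
      rw [plug_self, plug_self]
      congr 1
      funext b
      obtain ⟨b, rfl⟩ := τ.surjective b
      rw [← h1, perm_inv_apply, perm_inv_apply]
    · rw [plug_of_ne h i a ha, plug_of_ne h _ _ (fun e => ha (σ.injective e)), ← h2 a ha,
        perm_inv_apply]

/-- The Hadamard product `(P ⊗ Q)(n) = P(n) ⊗ Q(n)` with the diagonal structure. -/
noncomputable def hadamard (P Q : Operad k) : Operad k where
  obj n := P.obj n ⊗[k] Q.obj n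
  one := P.one ⊗ₜ Q.one
  act σ := TensorProduct.map (P.act σ) (Q.act σ)
  comp h i := TensorProduct.map₂ (P.comp h i) (Q.comp h i)
  act_one t := by
    induction t using TensorProduct.induction_on with
    | zero => simp
    | tmul p q => simp [P.act_one, Q.act_one]
    | add x y hx hy => rw [map_add, hx, hy]
  act_mul σ τ t := by
    induction t using TensorProduct.induction_on with
    | zero => simp
    | tmul p q => simp [P.act_mul, Q.act_mul]
    | add x y hx hy => simp only [map_add, hx, hy]
  one_comp h t := by
    induction t using TensorProduct.induction_on with
    | zero => simp
    | tmul p q => simp [TensorProduct.map₂_apply_tmul, P.one_comp, Q.one_comp]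
    | add x y hx hy => rw [map_add, hx, hy]
  comp_one h i t := by
    induction t using TensorProduct.induction_on with
    | zero => simp
    | tmul p q => simp [TensorProduct.map₂_apply_tmul, P.comp_one, Q.comp_one]
    | add x y hx hy => rw [map_add, LinearMap.add_apply, hx, hy]
  comp_comp_inner h₁ h₂ h₃ h₄ i j p q x := by
    induction p using TensorProduct.induction_on with
    | zero => simp
    | add _ _ h h' => simp only [map_add, LinearMap.add_apply, h, h']
    | tmul p p' =>
    induction q using TensorProduct.induction_on with
    | zero => simp
    | add _ _ h h' => simp only [map_add, LinearMap.add_apply, h, h']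
    | tmul q q' =>
    induction x using TensorProduct.induction_on with
    | zero => simp
    | add _ _ h h' => simp only [map_add, h, h']
    | tmul x x' =>
    simp only [TensorProduct.map₂_apply_tmul, TensorProduct.map_tmul]
    rw [P.comp_comp_inner h₁ h₂ h₃ h₄, Q.comp_comp_inner h₁ h₂ h₃ h₄]
  comp_comp_outer h₁ h₂ h₃ h₄ i a ha p q x := by
    induction p using TensorProduct.induction_on with
    | zero => simp
    | add _ _ h h' => simp only [map_add, LinearMap.add_apply, h, h']
    | tmul p p' =>
    induction q using TensorProduct.induction_on with
    | zero => simp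
    | add _ _ h h' => simp only [map_add, LinearMap.add_apply, h, h']
    | tmul q q' =>
    induction x using TensorProduct.induction_on with
    | zero => simp
    | add _ _ h h' => simp only [map_add, LinearMap.add_apply, h, h']
    | tmul x x' =>
    simp only [TensorProduct.map₂_apply_tmul, TensorProduct.map_tmul]
    rw [P.comp_comp_outer h₁ h₂ h₃ h₄, Q.comp_comp_outer h₁ h₂ h₃ h₄]
  comp_act h i σ τ ρ h1 h2 p q := by
    induction p using TensorProduct.induction_on with
    | zero => simp
    | add _ _ h h' => simp only [map_add, LinearMap.add_apply, h, h']
    | tmul p p' =>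
    induction q using TensorProduct.induction_on with
    | zero => simp
    | add _ _ h h' => simp only [map_add, h, h']
    | tmul q q' =>
    simp only [TensorProduct.map₂_apply_tmul, TensorProduct.map_tmul]
    rw [P.comp_act h i σ τ ρ h1 h2, Q.comp_act h i σ τ ρ h1 h2]

/-! ## Free operads, ideals and quotients -/

/-- A `Σ₂`-module over `k`, that is, a vector space with an involution `tau`, the right action
of the transposition. -/
structure SigmaTwoModule (k : Type u) [Field k] where
  carrier : Type u
  [addCommGroup : AddCommGroup carrier]
  [module : Module k carrier]
  tau : carrier →ₗ[k] carrier
  tau_tau : ∀ x, tau (tau x) = x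

attribute [instance] SigmaTwoModule.addCommGroup SigmaTwoModule.module

/-- Formal expressions in generators from `E` (of arity two) and the operations of an operad. -/
inductive Term (E : SigmaTwoModule k) : ℕ → Type u
  | zero (n : ℕ) : Term E n
  | add {n : ℕ} (s t : Term E n) : Term E n
  | smul {n : ℕ} (c : k) (t : Term E n) : Term E n
  | one : Term E 1
  | gen (e : E.carrier) : Term E 2
  | act {n : ℕ} (σ : Perm (Fin n)) (t : Term E n) : Term E n
  | comp {m n l : ℕ} (h : m + n = l + 1) (i : Fin m) (s : Term E m) (t : Term E n) : Term E l

/-- The smallest congruence on formal expressions that makes every arity a vector space, the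
structure operations (bi)linear, `gen` a linear and `Σ₂`-equivariant map, and that
forces the axioms of an operad. -/
inductive TermRel (E : SigmaTwoModule k) : ∀ {n : ℕ}, Term E n → Term E n → Prop
  | refl {n : ℕ} (t : Term E n) : TermRel E t t
  | symm {n : ℕ} {s t : Term E n} : TermRel E s t → TermRel E t s
  | trans {n : ℕ} {s t r : Term E n} : TermRel E s t → TermRel E t r → TermRel E s r
  | add_congr {n : ℕ} {s s' t t' : Term E n} : TermRel E s s' → TermRel E t t' →
      TermRel E (.add s t) (.add s' t')
  | smul_congr {n : ℕ} (c : k) {t t' : Term E n} : TermRel E t t' →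
      TermRel E (.smul c t) (.smul c t')
  | act_congr {n : ℕ} (σ : Perm (Fin n)) {t t' : Term E n} : TermRel E t t' →
      TermRel E (.act σ t) (.act σ t')
  | comp_congr {m n l : ℕ} (h : m + n = l + 1) (i : Fin m) {s s' : Term E m}
      {t t' : Term E n} : TermRel E s s' → TermRel E t t' →
      TermRel E (.comp h i s t) (.comp h i s' t')
  | add_assoc {n : ℕ} (s t r : Term E n) :
      TermRel E (.add (.add s t) r) (.add s (.add t r))
  | add_comm {n : ℕ} (s t : Term E n) : TermRel E (.add s t) (.add t s)
  | zero_add {n : ℕ} (t : Term E n) : TermRel E (.add (.zero n) t) t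
  | neg_add {n : ℕ} (t : Term E n) : TermRel E (.add (.smul (-1) t) t) (.zero n)
  | smul_add {n : ℕ} (c : k) (s t : Term E n) :
      TermRel E (.smul c (.add s t)) (.add (.smul c s) (.smul c t))
  | add_smul {n : ℕ} (c d : k) (t : Term E n) :
      TermRel E (.smul (c + d) t) (.add (.smul c t) (.smul d t))
  | mul_smul {n : ℕ} (c d : k) (t : Term E n) :
      TermRel E (.smul (c * d) t) (.smul c (.smul d t))
  | one_smul {n : ℕ} (t : Term E n) : TermRel E (.smul 1 t) t
  | gen_add (e f : E.carrier) : TermRel E (.gen (e + f)) (.add (.gen e) (.gen f))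
  | gen_smul (c : k) (e : E.carrier) : TermRel E (.gen (c • e)) (.smul c (.gen e))
  | gen_tau (e : E.carrier) : TermRel E (.gen (E.tau e)) (.act (Equiv.swap 0 1) (.gen e))
  | act_add {n : ℕ} (σ : Perm (Fin n)) (s t : Term E n) :
      TermRel E (.act σ (.add s t)) (.add (.act σ s) (.act σ t))
  | act_smul {n : ℕ} (σ : Perm (Fin n)) (c : k) (t : Term E n) :
      TermRel E (.act σ (.smul c t)) (.smul c (.act σ t))
  | comp_add_left {m n l : ℕ} (h : m + n = l + 1) (i : Fin m) (s s' : Term E m)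
      (t : Term E n) :
      TermRel E (.comp h i (.add s s') t) (.add (.comp h i s t) (.comp h i s' t))
  | comp_add_right {m n l : ℕ} (h : m + n = l + 1) (i : Fin m) (s : Term E m)
      (t t' : Term E n) :
      TermRel E (.comp h i s (.add t t')) (.add (.comp h i s t) (.comp h i s t'))
  | comp_smul_left {m n l : ℕ} (h : m + n = l + 1) (i : Fin m) (c : k) (s : Term E m)
      (t : Term E n) : TermRel E (.comp h i (.smul c s) t) (.smul c (.comp h i s t))
  | comp_smul_right {m n l : ℕ} (h : m + n = l + 1) (i : Fin m) (c : k) (s : Term E m)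
      (t : Term E n) : TermRel E (.comp h i s (.smul c t)) (.smul c (.comp h i s t))
  | act_one {n : ℕ} (t : Term E n) : TermRel E (.act 1 t) t
  | act_mul {n : ℕ} (σ τ : Perm (Fin n)) (t : Term E n) :
      TermRel E (.act (σ * τ) t) (.act τ (.act σ t))
  | one_comp {n : ℕ} (h : 1 + n = n + 1) (t : Term E n) : TermRel E (.comp h 0 .one t) t
  | comp_one {m : ℕ} (h : m + 1 = m + 1) (i : Fin m) (t : Term E m) :
      TermRel E (.comp h i t .one) t
  | comp_comp_inner {m n r l s t : ℕ} (h₁ : m + n = l + 1) (h₂ : l + r = t + 1)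
      (h₃ : n + r = s + 1) (h₄ : m + s = t + 1) (i : Fin m) (j : Fin n)
      (p : Term E m) (q : Term E n) (x : Term E r) :
      TermRel E (.comp h₂ (innerSlot h₁ i j) (.comp h₁ i p q) x)
        (.comp h₄ i p (.comp h₃ j q x))
  | comp_comp_outer {m n r l s t : ℕ} (h₁ : m + n = l + 1) (h₂ : l + r = t + 1)
      (h₃ : m + r = s + 1) (h₄ : s + n = t + 1) (i a : Fin m) (ha : a ≠ i)
      (p : Term E m) (q : Term E n) (x : Term E r) :
      TermRel E (.comp h₂ (outerSlot h₁ i a ha) (.comp h₁ i p q) x)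
        (.comp h₄ (outerSlot h₃ a i ha.symm) (.comp h₃ a p x) q)
  | comp_act {m n l : ℕ} (h : m + n = l + 1) (i : Fin m) (σ : Perm (Fin m))
      (τ : Perm (Fin n)) (ρ : Perm (Fin l))
      (h₁ : ∀ j, ρ (innerSlot h i j) = innerSlot h (σ i) (τ j))
      (h₂ : ∀ a (ha : a ≠ i), ρ (outerSlot h i a ha) =
        outerSlot h (σ i) (σ a) (fun e => ha (σ.injective e)))
      (p : Term E m) (q : Term E n) :
      TermRel E (.comp h i (.act σ p) (.act τ q)) (.act ρ (.comp h (σ i) p q))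

/-- Formal expressions up to `TermRel`. -/
def termSetoid (E : SigmaTwoModule k) (n : ℕ) : Setoid (Term E n) where
  r := TermRel E
  iseqv := ⟨.refl, .symm, .trans⟩

/-- The underlying spaces of the free operad. -/
def FreeObj (E : SigmaTwoModule k) (n : ℕ) : Type u := Quotient (termSetoid E n)

namespace FreeObj

variable {E : SigmaTwoModule k} {n : ℕ}

/-- The class of an expression. -/
def mk (t : Term E n) : FreeObj E n := Quotient.mk (termSetoid E n) t

lemma sound {s t : Term E n} (h : TermRel E s t) : mk s = mk t := Quotient.sound h

lemma ind {p : FreeObj E n → Prop} (h : ∀ t, p (mk t)) (x : FreeObj E n) : p x :=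
  Quotient.ind h x

instance : Zero (FreeObj E n) := ⟨mk (.zero n)⟩

instance : Add (FreeObj E n) :=
  ⟨Quotient.map₂ Term.add fun _ _ h _ _ h' => TermRel.add_congr h h'⟩

instance : SMul k (FreeObj E n) :=
  ⟨fun c => Quotient.map (Term.smul c) fun _ _ h => TermRel.smul_congr c h⟩

instance : Neg (FreeObj E n) := ⟨fun x => (-1 : k) • x⟩

instance : AddCommGroup (FreeObj E n) where
  add_assoc x y z := by
    induction x using ind; induction y using ind; induction z using ind
    exact sound (.add_assoc _ _ _)
  zero_add x := by
    induction x using ind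
    exact sound (.zero_add _)
  add_zero x := by
    induction x using ind
    exact sound ((TermRel.add_comm _ _).trans (.zero_add _))
  add_comm x y := by
    induction x using ind; induction y using ind
    exact sound (.add_comm _ _)
  neg_add_cancel x := by
    induction x using ind
    exact sound (.neg_add _)
  nsmul := nsmulRec
  zsmul := zsmulRec

instance : Module k (FreeObj E n) :=
  Module.ofMinimalAxioms
    (fun c x y => by
      induction x using ind; induction y using ind
      exact sound (.smul_add _ _ _))
    (fun c d x => by
      induction x using ind
      exact sound (.add_smul _ _ _))
    (fun c d x => by
      induction x using ind
      exact sound (.mul_smul _ _ _))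
    (fun x => by
      induction x using ind
      exact sound (.one_smul _))

end FreeObj

/-- The free operad `Γ(E)` generated by a `Σ₂`-module `E` placed in arity two. -/
def freeOperad (E : SigmaTwoModule k) : Operad k where
  obj := FreeObj E
  one := FreeObj.mk .one
  act σ :=
    { toFun := Quotient.map (Term.act σ) fun _ _ h => TermRel.act_congr σ h
      map_add' := fun x y => by
        induction x using FreeObj.ind; induction y using FreeObj.ind
        exact FreeObj.sound (.act_add _ _ _)
      map_smul' := fun c x => by
        induction x using FreeObj.ind
        exact FreeObj.sound (.act_smul _ _ _) }
  comp h i := LinearMap.mk₂ k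
    (Quotient.map₂ (Term.comp h i) fun _ _ h₁ _ _ h₂ => TermRel.comp_congr h i h₁ h₂)
    (fun x y z => by
      induction x using FreeObj.ind; induction y using FreeObj.ind; induction z using FreeObj.ind
      exact FreeObj.sound (.comp_add_left _ _ _ _ _))
    (fun c x y => by
      induction x using FreeObj.ind; induction y using FreeObj.ind
      exact FreeObj.sound (.comp_smul_left _ _ _ _ _))
    (fun x y z => by
      induction x using FreeObj.ind; induction y using FreeObj.ind; induction z using FreeObj.ind
      exact FreeObj.sound (.comp_add_right _ _ _ _ _))
    (fun c x y => by
      induction x using FreeObj.ind; induction y using FreeObj.ind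
      exact FreeObj.sound (.comp_smul_right _ _ _ _ _))
  act_one x := by
    induction x using FreeObj.ind
    exact FreeObj.sound (.act_one _)
  act_mul σ τ x := by
    induction x using FreeObj.ind
    exact FreeObj.sound (.act_mul _ _ _)
  one_comp h x := by
    induction x using FreeObj.ind
    exact FreeObj.sound (.one_comp _ _)
  comp_one h i x := by
    induction x using FreeObj.ind
    exact FreeObj.sound (.comp_one _ _ _)
  comp_comp_inner h₁ h₂ h₃ h₄ i j p q x := by
    induction p using FreeObj.ind; induction q using FreeObj.ind; induction x using FreeObj.ind
    exact FreeObj.sound (.comp_comp_inner h₁ h₂ h₃ h₄ i j _ _ _)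
  comp_comp_outer h₁ h₂ h₃ h₄ i a ha p q x := by
    induction p using FreeObj.ind; induction q using FreeObj.ind; induction x using FreeObj.ind
    exact FreeObj.sound (.comp_comp_outer h₁ h₂ h₃ h₄ i a ha _ _ _)
  comp_act h i σ τ ρ h1 h2 p q := by
    induction p using FreeObj.ind; induction q using FreeObj.ind
    exact FreeObj.sound (.comp_act h i σ τ ρ h1 h2 _ _)

/-- The inclusion of the generators, `E → Γ(E)(2)`. -/
def freeGen (E : SigmaTwoModule k) : E.carrier →ₗ[k] (freeOperad E).obj 2 where
  toFun e := FreeObj.mk (.gen e)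
  map_add' _ _ := FreeObj.sound (.gen_add _ _)
  map_smul' _ _ := FreeObj.sound (.gen_smul _ _)

/-- Operadic ideals. -/
structure OperadIdeal (P : Operad k) where
  carrier : ∀ n, Submodule k (P.obj n)
  act_mem : ∀ {n : ℕ} (σ : Perm (Fin n)) (p : P.obj n), p ∈ carrier n → P.act σ p ∈ carrier n
  comp_mem_left : ∀ {m n l : ℕ} (h : m + n = l + 1) (i : Fin m) (p : P.obj m) (q : P.obj n),
    p ∈ carrier m → P.comp h i p q ∈ carrier l
  comp_mem_right : ∀ {m n l : ℕ} (h : m + n = l + 1) (i : Fin m) (p : P.obj m) (q : P.obj n),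
    q ∈ carrier n → P.comp h i p q ∈ carrier l

/-- The smallest operadic ideal that contains a given subset of the arity three part. -/
def idealSpan (P : Operad k) (R : Set (P.obj 3)) : OperadIdeal P where
  carrier n := ⨅ I : {I : OperadIdeal P // R ⊆ I.carrier 3}, I.1.carrier n
  act_mem σ p hp := by
    simp only [Submodule.mem_iInf] at hp ⊢
    exact fun I => I.1.act_mem σ p (hp I)
  comp_mem_left h i p q hp := by
    simp only [Submodule.mem_iInf] at hp ⊢
    exact fun I => I.1.comp_mem_left h i p q (hp I)
  comp_mem_right h i p q hq := by
    simp only [Submodule.mem_iInf] at hq ⊢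
    exact fun I => I.1.comp_mem_right h i p q (hq I)

/-- The operation `∘ᵢ` on the quotient by an ideal. -/
def quotComp {P : Operad k} (I : OperadIdeal P) {m n l : ℕ} (h : m + n = l + 1) (i : Fin m) :
    (P.obj m ⧸ I.carrier m) →ₗ[k] (P.obj n ⧸ I.carrier n) →ₗ[k] (P.obj l ⧸ I.carrier l) :=
  Submodule.liftQ (I.carrier m)
    { toFun := fun p => Submodule.mapQ (I.carrier n) (I.carrier l) (P.comp h i p)
        fun q hq => I.comp_mem_right h i p q hq
      map_add' := fun p p' => by ext q; simp
      map_smul' := fun c p => by ext q; simp }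
    fun p hp => by
      rw [LinearMap.mem_ker]
      ext q
      simpa using I.comp_mem_left h i p q hp

lemma quotComp_mk {P : Operad k} (I : OperadIdeal P) {m n l : ℕ} (h : m + n = l + 1)
    (i : Fin m) (p : P.obj m) (q : P.obj n) :
    quotComp I h i (Submodule.Quotient.mk p) (Submodule.Quotient.mk q) =
      Submodule.Quotient.mk (P.comp h i p q) := rfl

/-- The right action on the quotient by an ideal. -/
def quotAct {P : Operad k} (I : OperadIdeal P) {n : ℕ} (σ : Perm (Fin n)) :
    (P.obj n ⧸ I.carrier n) →ₗ[k] (P.obj n ⧸ I.carrier n) :=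
  Submodule.mapQ _ _ (P.act σ) fun p hp => I.act_mem σ p hp

lemma quotAct_mk {P : Operad k} (I : OperadIdeal P) {n : ℕ} (σ : Perm (Fin n)) (p : P.obj n) :
    quotAct I σ (Submodule.Quotient.mk p) = Submodule.Quotient.mk (P.act σ p) := rfl

/-- The quotient of an operad by an ideal. -/
def quotientOperad (P : Operad k) (I : OperadIdeal P) : Operad k where
  obj n := P.obj n ⧸ I.carrier n
  one := Submodule.Quotient.mk P.one
  act σ := quotAct I σ
  comp h i := quotComp I h i
  act_one p := by
    obtain ⟨p, rfl⟩ := Submodule.Quotient.mk_surjective _ p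
    rw [quotAct_mk, P.act_one]
  act_mul σ τ p := by
    obtain ⟨p, rfl⟩ := Submodule.Quotient.mk_surjective _ p
    rw [quotAct_mk, quotAct_mk, quotAct_mk, P.act_mul]
  one_comp h p := by
    obtain ⟨p, rfl⟩ := Submodule.Quotient.mk_surjective _ p
    rw [quotComp_mk, P.one_comp]
  comp_one h i p := by
    obtain ⟨p, rfl⟩ := Submodule.Quotient.mk_surjective _ p
    rw [quotComp_mk, P.comp_one]
  comp_comp_inner h₁ h₂ h₃ h₄ i j p q x := by
    obtain ⟨p, rfl⟩ := Submodule.Quotient.mk_surjective _ p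
    obtain ⟨q, rfl⟩ := Submodule.Quotient.mk_surjective _ q
    obtain ⟨x, rfl⟩ := Submodule.Quotient.mk_surjective _ x
    rw [quotComp_mk, quotComp_mk, quotComp_mk, quotComp_mk, P.comp_comp_inner h₁ h₂ h₃ h₄]
  comp_comp_outer h₁ h₂ h₃ h₄ i a ha p q x := by
    obtain ⟨p, rfl⟩ := Submodule.Quotient.mk_surjective _ p
    obtain ⟨q, rfl⟩ := Submodule.Quotient.mk_surjective _ q
    obtain ⟨x, rfl⟩ := Submodule.Quotient.mk_surjective _ x
    rw [quotComp_mk, quotComp_mk, quotComp_mk, quotComp_mk, P.comp_comp_outer h₁ h₂ h₃ h₄]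
  comp_act h i σ τ ρ h1 h2 p q := by
    obtain ⟨p, rfl⟩ := Submodule.Quotient.mk_surjective _ p
    obtain ⟨q, rfl⟩ := Submodule.Quotient.mk_surjective _ q
    rw [quotAct_mk, quotAct_mk, quotComp_mk, quotComp_mk, quotAct_mk,
      P.comp_act h i σ τ ρ h1 h2]

/-- The projection to the quotient. -/
def quotientProj (P : Operad k) (I : OperadIdeal P) : OperadHom P (quotientOperad P I) where
  map n := Submodule.mkQ (I.carrier n)
  map_one := rfl
  map_act _ _ := rfl
  map_comp _ _ _ _ := rfl

/-! ## Quadratic operads and the quadratic dual -/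

/-- An operad is quadratic if it is isomorphic to `Γ(E)/(R)` for a `Σ₂`-module `E` in arity two
and a space of relations `R ⊆ Γ(E)(3)`. -/
def Operad.IsQuadratic (P : Operad k) : Prop :=
  ∃ (E : SigmaTwoModule k) (R : Submodule k ((freeOperad E).obj 3)),
    Nonempty (OperadIso (quotientOperad (freeOperad E) (idealSpan (freeOperad E) R)) P)

/-- For a linear map `g : V → Q(2)`, the map
`(V ⊗ V)³ → Q(3)`, `(xⱼ ⊗ yⱼ)ⱼ ↦ ∑ⱼ (g(xⱼ) ∘₁ g(yⱼ)) cʲ`, with `c` the cyclic permutation of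
order three. For `V = E` and `Q = Γ(E)` it is an isomorphism `(E ⊗ E)³ ≅ Γ(E)(3)`. -/
noncomputable def cubicMap {V : Type u} [AddCommGroup V] [Module k V] (Q : Operad k)
    (g : V →ₗ[k] Q.obj 2) : (Fin 3 → V ⊗[k] V) →ₗ[k] Q.obj 3 :=
  ∑ j : Fin 3, Q.act (finRotate 3 ^ j.1) ∘ₗ
    TensorProduct.lift (Q.comp (rfl : 2 + 2 = 3 + 1) 0) ∘ₗ TensorProduct.map g g ∘ₗ
      LinearMap.proj j

/-- The quadratic relations of `P`: the kernel of `Γ(P(2))(3) ≅ (P(2) ⊗ P(2))³ → P(3)`. -/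
noncomputable def quadRelations (P : Operad k) :
    Submodule k (Fin 3 → P.obj 2 ⊗[k] P.obj 2) :=
  LinearMap.ker (cubicMap P LinearMap.id)

/-- The `Σ₂`-module `E^∨ = E^# ⊗ sgn₂` for `E = P(2)`. -/
noncomputable def dualGenerators (P : Operad k) : SigmaTwoModule k where
  carrier := Module.Dual k (P.obj 2)
  tau := -(P.act (Equiv.swap 0 1)).dualMap
  tau_tau x := by
    ext p
    simp [← P.act_mul, P.act_one]

/-- The annihilator `R^⊥` of the quadratic relations of `P`, in
`(E^∨ ⊗ E^∨)³ ≅ Γ(E^∨)(3)`, where `E = P(2)`. -/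
noncomputable def dualRelations (P : Operad k) :
    Submodule k (Fin 3 → Module.Dual k (P.obj 2) ⊗[k] Module.Dual k (P.obj 2)) where
  carrier := {ξ | ∀ r ∈ quadRelations P,
    ∑ j, TensorProduct.dualDistrib k (P.obj 2) (P.obj 2) (ξ j) (r j) = 0}
  add_mem' {ξ ξ'} h h' r hr := by
    simp only [Pi.add_apply, map_add, LinearMap.add_apply, Finset.sum_add_distrib, h r hr,
      h' r hr, add_zero]
  zero_mem' r hr := by simp only [Pi.zero_apply, map_zero, LinearMap.zero_apply,
    Finset.sum_const_zero]
  smul_mem' c ξ h r hr := by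
    simp only [Pi.smul_apply, map_smul, LinearMap.smul_apply, ← Finset.smul_sum, h r hr,
      smul_zero]

/-- The inclusion of the generators `E^∨ → Γ(E^∨)(2)`, where `E = P(2)`. -/
noncomputable def dualFreeGen (P : Operad k) :
    Module.Dual k (P.obj 2) →ₗ[k] (freeOperad (dualGenerators P)).obj 2 :=
  freeGen (dualGenerators P)

/-- The ideal `(R^⊥)` of `Γ(E^∨)`, where `E = P(2)`. -/
noncomputable def dualIdeal (P : Operad k) : OperadIdeal (freeOperad (dualGenerators P)) :=
  idealSpan _ ((dualRelations P).map (cubicMap _ (dualFreeGen P)))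

/-- The quadratic dual operad `P^! = Γ(E^∨)/(R^⊥)`, where `E = P(2)`. -/
noncomputable def quadDual (P : Operad k) : Operad k :=
  quotientOperad (freeOperad (dualGenerators P)) (dualIdeal P)

/-- The canonical map `P(2)^# → P^!(2)`. -/
noncomputable def dualGen (P : Operad k) : Module.Dual k (P.obj 2) →ₗ[k] (quadDual P).obj 2 :=
  (quotientProj _ (dualIdeal P)).map 2 ∘ₗ dualFreeGen P

/-- The element of `W ⊗ P^!(2)` that corresponds to a linear map `φ : P(2) → W` under
`Lin(P(2), W) ≅ W ⊗ P(2)^# ≅ W ⊗ P^!(2)`. -/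
noncomputable def homToTensor (P : Operad k) [FiniteDimensional k (P.obj 2)] {W : Type u}
    [AddCommGroup W] [Module k W] (φ : P.obj 2 →ₗ[k] W) : W ⊗[k] (quadDual P).obj 2 :=
  TensorProduct.map LinearMap.id (dualGen P)
    (TensorProduct.comm k _ _ ((dualTensorHomEquiv k (P.obj 2) W).symm φ))

/-! ## The graded Lie algebra of invariants of the suspension -/

/-- `(T(n) ⊗ sgnₙ)^{Σₙ}`, which is the part of degree `n - 1` of `T^Σ_*`. -/
def Operad.signInv (T : Operad k) (n : ℕ) : Submodule k (T.obj n) where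
  carrier := {t | ∀ σ : Perm (Fin n), T.act σ t = ((Equiv.Perm.sign σ : ℤˣ) : ℤ) • t}
  add_mem' h h' σ := by rw [map_add, h σ, h' σ, smul_add]
  zero_mem' σ := by simp
  smul_mem' c t h σ := by rw [map_smul, h σ, smul_comm]

/-- The sum `∑_σ sgn(σ) t σ`. -/
def Operad.signSum (T : Operad k) (n : ℕ) : T.obj n →ₗ[k] T.signInv n :=
  LinearMap.codRestrict (T.signInv n)
    (∑ σ : Perm (Fin n), ((Equiv.Perm.sign σ : ℤˣ) : ℤ) • T.act σ)
    (fun t τ => by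
      simp only [LinearMap.sum_apply, LinearMap.smul_apply, map_sum, map_zsmul, ← T.act_mul,
        Finset.smul_sum]
      refine Fintype.sum_equiv (Equiv.mulRight τ) _ _ fun σ => ?_
      simp only [Equiv.coe_mulRight, Equiv.Perm.sign_mul, smul_smul, Units.val_mul]
      congr 1
      rcases Int.units_eq_one_or (Equiv.Perm.sign τ) with h | h <;> simp [h])

/-- The averaging map `Aver : T(n) ⊗ sgnₙ → (T(n) ⊗ sgnₙ)^{Σₙ}`. -/
noncomputable def Operad.signAver (T : Operad k) (n : ℕ) : T.obj n →ₗ[k] T.signInv n :=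
  (n.factorial : k)⁻¹ • T.signSum n

/-- `f ∘ g = ∑_{1 ≤ i ≤ m} (-1)^{(n-1)(i-1)} f ∘ᵢ g` for `f ∈ T(m)`, `g ∈ T(n)`. -/
def Operad.preLie (T : Operad k) {m n l : ℕ} (h : m + n = l + 1) :
    T.obj m →ₗ[k] T.obj n →ₗ[k] T.obj l :=
  ∑ i : Fin m, (-1 : k) ^ ((n + 1) * i.1) • T.comp h i

/-- `[f, g] = f ∘ g - (-1)^{(m-1)(n-1)} g ∘ f` for `f ∈ T(m)`, `g ∈ T(n)`. -/
def Operad.bracket (T : Operad k) {m n l : ℕ} (h : m + n = l + 1) :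
    T.obj m →ₗ[k] T.obj n →ₗ[k] T.obj l :=
  T.preLie h - (-1 : k) ^ ((m + 1) * (n + 1)) • (T.preLie ((add_comm n m).trans h)).flip

/-- The Lie bracket on `T^Σ_*`. It is induced by `[-, -]` via the identification
of invariants with coinvariants, whose inverse is induced by the averaging. -/
noncomputable def Operad.bracketInv (T : Operad k) {m n l : ℕ} (h : m + n = l + 1) :
    T.signInv m →ₗ[k] T.signInv n →ₗ[k] T.signInv l :=
  ((T.bracket h).compr₂ (T.signAver l)).domRestrict₁₂ (T.signInv m) (T.signInv n)

/-- The map `δ^Σ_φ t = [φ, t]` from degree `d` to degree `d + 1`, where `φ` has degree one. -/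
noncomputable def Operad.deltaInv (T : Operad k) (φ : T.signInv 2) (d : ℕ) :
    T.signInv (d + 1) →ₗ[k] T.signInv (d + 2) :=
  T.bracketInv (by omega : 2 + (d + 1) = d + 2 + 1) φ

/-- The map of sign-invariants induced by a morphism of operads. -/
def OperadHom.mapInv {S T : Operad k} (f : OperadHom S T) (n : ℕ) :
    S.signInv n →ₗ[k] T.signInv n :=
  (f.map n).restrict fun t ht σ => by rw [← f.map_act, ht σ, map_zsmul]

/-! ## The canonical element -/

/-- The identity morphism. -/
def OperadHom.id (P : Operad k) : OperadHom P P where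
  map _ := LinearMap.id
  map_one := rfl
  map_act _ _ := rfl
  map_comp _ _ _ _ := rfl

/-- The morphism `f ⊗ g` of Hadamard products. -/
noncomputable def hadamardHom {P P' Q Q' : Operad k} (f : OperadHom P P')
    (g : OperadHom Q Q') : OperadHom (hadamard P Q) (hadamard P' Q') where
  map n := TensorProduct.map (f.map n) (g.map n)
  map_one := by
    change TensorProduct.map _ _ (P.one ⊗ₜ[k] Q.one) = P'.one ⊗ₜ[k] Q'.one
    rw [TensorProduct.map_tmul, f.map_one, g.map_one]
  map_act σ t := by
    change TensorProduct.map _ _ (TensorProduct.map _ _ t) =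
      TensorProduct.map _ _ (TensorProduct.map _ _ t)
    induction t using TensorProduct.induction_on with
    | zero => simp
    | tmul p q => simp [f.map_act, g.map_act]
    | add x y hx hy => simp only [map_add, hx, hy]
  map_comp h i s t := by
    change TensorProduct.map _ _ (TensorProduct.map₂ (P.comp h i) (Q.comp h i) s t) =
      TensorProduct.map₂ (P'.comp h i) (Q'.comp h i) (TensorProduct.map _ _ s)
        (TensorProduct.map _ _ t)
    change P.obj _ ⊗[k] Q.obj _ at s t
    induction s using TensorProduct.induction_on with
    | zero => simp only [map_zero, LinearMap.zero_apply]
    | add _ _ h h' => simp only [map_add, LinearMap.add_apply, h, h']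
    | tmul p p' =>
    induction t using TensorProduct.induction_on with
    | zero => simp only [map_zero]
    | add _ _ h h' => simp only [map_add, h, h']
    | tmul q q' =>
    simp only [TensorProduct.map₂_apply_tmul, TensorProduct.map_tmul, f.map_comp, g.map_comp]

lemma dualGen_swap (P : Operad k) (ξ : Module.Dual k (P.obj 2)) :
    (quadDual P).act (Equiv.swap 0 1) (dualGen P ξ) =
      -dualGen P ((P.act (Equiv.swap 0 1)).dualMap ξ) := by
  rw [← map_neg]
  have h : dualFreeGen P (-(P.act (Equiv.swap 0 1)).dualMap ξ) =
      (freeOperad (dualGenerators P)).act (Equiv.swap 0 1) (dualFreeGen P ξ) :=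
    FreeObj.sound (.gen_tau (E := dualGenerators P) ξ)
  change _ = (quotientProj _ (dualIdeal P)).map 2 (dualFreeGen P _)
  rw [h, (quotientProj _ (dualIdeal P)).map_act]
  rfl

lemma dualTensorHom_map {V W : Type u} [AddCommGroup V] [Module k V] [AddCommGroup W]
    [Module k W] (f : V →ₗ[k] V) (g : W →ₗ[k] W) (z : Module.Dual k V ⊗[k] W) :
    dualTensorHom k V W (TensorProduct.map f.dualMap g z) =
      g ∘ₗ dualTensorHom k V W z ∘ₗ f := by
  induction z using TensorProduct.induction_on with
  | zero => simp
  | tmul ξ w => ext v; simp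
  | add x y hx hy => simp only [map_add, hx, hy, LinearMap.add_comp, LinearMap.comp_add]

lemma homToTensor_mem (P Q : Operad k) [FiniteDimensional k (P.obj 2)]
    (φ : P.obj 2 →ₗ[k] Q.obj 2)
    (hφ : ∀ p, φ (P.act (Equiv.swap 0 1) p) = Q.act (Equiv.swap 0 1) (φ p)) :
    homToTensor P φ ∈ (hadamard Q (quadDual P)).signInv 2 := by
  intro σ
  have hσ : σ = 1 ∨ σ = Equiv.swap 0 1 := by revert σ; decide
  rcases hσ with rfl | rfl
  · rw [Equiv.Perm.sign_one]
    exact ((hadamard Q (quadDual P)).act_one _).trans (one_smul ℤ _).symm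
  · have key : ∀ z : Module.Dual k (P.obj 2) ⊗[k] Q.obj 2,
        (hadamard Q (quadDual P)).act (Equiv.swap 0 1)
          (TensorProduct.map LinearMap.id (dualGen P) (TensorProduct.comm k _ _ z)) =
        -TensorProduct.map LinearMap.id (dualGen P) (TensorProduct.comm k _ _
          (TensorProduct.map (P.act (Equiv.swap 0 1)).dualMap (Q.act (Equiv.swap 0 1)) z)) := by
      intro z
      change TensorProduct.map _ _ _ = _
      induction z using TensorProduct.induction_on with
      | zero => simp
      | tmul ξ w =>
        simp only [TensorProduct.comm_tmul, TensorProduct.map_tmul, LinearMap.id_apply,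
          dualGen_swap, TensorProduct.tmul_neg]
      | add x y hx hy => simp only [map_add, hx, hy, neg_add]
    have hz : TensorProduct.map (P.act (Equiv.swap 0 1)).dualMap (Q.act (Equiv.swap 0 1))
        ((dualTensorHomEquiv k (P.obj 2) (Q.obj 2)).symm φ) =
        (dualTensorHomEquiv k (P.obj 2) (Q.obj 2)).symm φ := by
      rw [LinearEquiv.eq_symm_apply]
      change dualTensorHom k _ _ _ = φ
      rw [dualTensorHom_map]
      have : dualTensorHom k _ _ ((dualTensorHomEquiv k (P.obj 2) (Q.obj 2)).symm φ) = φ :=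
        (dualTensorHomEquiv k (P.obj 2) (Q.obj 2)).apply_symm_apply φ
      rw [this]
      ext p
      simp only [LinearMap.comp_apply, hφ, ← Q.act_mul]
      simp [Q.act_one]
    rw [Equiv.Perm.sign_swap (by decide)]
    refine (key _).trans ?_
    rw [hz]
    exact (neg_one_smul ℤ _).symm

/-- The canonical element `χ`, corresponding to the identity of `P(2)`. -/
noncomputable def canonicalElement (P : Operad k) [FiniteDimensional k (P.obj 2)] :
    (hadamard P (quadDual P)).signInv 2 :=
  ⟨homToTensor P LinearMap.id, homToTensor_mem P P _ fun _ => rfl⟩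

/-! ## Algebras and their operadic cochain complex -/

/-- An algebra over the operad `P`: a vector space `A` with a morphism `α : P → End_A`. -/
structure PAlgebra (P : Operad k) where
  carrier : Type u
  [addCommGroup : AddCommGroup carrier]
  [module : Module k carrier]
  action : OperadHom P (endOperad k carrier)

attribute [instance] PAlgebra.addCommGroup PAlgebra.module

/-- The restriction of the structure of a `Q`-algebra along a morphism `f : P → Q`. -/
@[reducible]
def PAlgebra.pullback {P Q : Operad k} (f : OperadHom P Q) (A : PAlgebra Q) : PAlgebra P where
  carrier := A.carrier
  action := A.action.comp f

/-- The operad `End_A ⊗ P^!`. -/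
noncomputable abbrev coeffOperad {P : Operad k} (A : PAlgebra P) : Operad k :=
  hadamard (endOperad k A.carrier) (quadDual P)

/-- The operadic cochains
`C^d_P(A;A) = [Lin((↓A)^{⊗ (d+1)}, ↓A) ⊗ P^!(d+1)]^{Σ_{d+1}}
≅ (Lin(A^{⊗ (d+1)}, A) ⊗ P^!(d+1) ⊗ sgn_{d+1})^{Σ_{d+1}}`. -/
noncomputable abbrev Cochains {P : Operad k} (A : PAlgebra P) (d : ℕ) : Type u :=
  (coeffOperad A).signInv (d + 1)

/-- For `f` of arity `m + 1` and `g` of arity `n` that are sign-invariant, this is the sum of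
`sgn(σ) (f ∘₁ g) σ` over all `(n, m)`-unshuffles `σ`, written as a sum over all permutations.
On `C_P(A;A)` it is the pre-Lie product of coderivations of the cofree nilpotent
`P^!`-coalgebra cogenerated by `↓A`: the composition of `f` with the coderivation that
extends `g`. -/
noncomputable def Operad.coderComp (T : Operad k) {m n l : ℕ} (h : m + 1 + n = l + 1) :
    T.obj (m + 1) →ₗ[k] T.obj n →ₗ[k] T.signInv l :=
  ((n.factorial : k) * (m.factorial : k))⁻¹ • (T.comp h 0).compr₂ (T.signSum l)

/-- The structure element `D ∈ C¹_P(A;A)`. It corresponds to the structure map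
`α : P(2) → End_A(2)` of the algebra `A`. -/
noncomputable def structureElement {P : Operad k} [FiniteDimensional k (P.obj 2)]
    (A : PAlgebra P) : Cochains A 1 :=
  ⟨homToTensor P (A.action.map 2),
    homToTensor_mem P (endOperad k A.carrier) _ fun p => A.action.map_act _ p⟩

/-- The differential `d_P` of the operadic cochain complex: the commutator
`d_P f = [D, f] = D ⋆ f - (-1)^{|f|} f ⋆ D` of coderivations. -/
noncomputable def cochainDiff {P : Operad k} [FiniteDimensional k (P.obj 2)]
    (A : PAlgebra P) (d : ℕ) : Cochains A d →ₗ[k] Cochains A (d + 1) :=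
  ((coeffOperad A).coderComp (by omega : 1 + 1 + (d + 1) = d + 2 + 1)
      (structureElement A).1 -
    (-1 : k) ^ d • ((coeffOperad A).coderComp (by omega : d + 1 + 2 = d + 2 + 1)).flip
      (structureElement A).1) ∘ₗ Submodule.subtype _

/-! ## Natural operations without inputs -/

/-- Rooted trees with `n` input legs labelled by `1, …, n`, with no white vertices and with
at least binary black vertices decorated by elements of `P`. They are generated from the tree
without vertices and from the decorated corollas by grafting the root of one tree to an input
leg of another one and by relabelling the legs. -/
inductive DecTree (P : Operad k) : ℕ → Type u
  | edge : DecTree P 1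
  | corolla {n : ℕ} (hn : 2 ≤ n) (p : P.obj n) : DecTree P n
  | graft {m n l : ℕ} (h : m + n = l + 1) (i : Fin m) (S : DecTree P m) (T : DecTree P n) :
      DecTree P l
  | relabel {n : ℕ} (σ : Perm (Fin n)) (T : DecTree P n) : DecTree P n

/-- The composition in `Q` along the tree whose decorations are moved to `Q` by `f`. -/
def DecTree.eval {P Q : Operad k} (f : OperadHom P Q) : ∀ {n : ℕ}, DecTree P n → Q.obj n
  | _, .edge => Q.one
  | n, .corolla _ p => f.map n p
  | _, .graft h i S T => Q.comp h i (S.eval f) (T.eval f)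
  | _, .relabel σ T => Q.act σ (T.eval f)

/-- The natural operation `U_{(T, Φ)}` without inputs that is given by a tree `T` and by a linear
map `Φ : k → P^!(d+1)`, `Φ(1) = φ`, as a family indexed by all `P`-algebras `A`: the
value at `A` is `Aver(T_A ⊗ φ)`, with `T_A` the composition along `T` in `End_A`. -/
noncomputable def constantOperation {P : Operad k} {d : ℕ} (T : DecTree P (d + 1))
    (φ : (quadDual P).obj (d + 1)) (A : PAlgebra P) : Cochains A d :=
  (coeffOperad A).signAver (d + 1) (T.eval A.action ⊗ₜ[k] φ)

/-- The space `B^d_P(0)` spanned by all natural operations without inputs. -/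
noncomputable def natConstants (P : Operad k) (d : ℕ) :
    Submodule k (∀ A : PAlgebra P, Cochains A d) :=
  Submodule.span k {U | ∃ (T : DecTree P (d + 1)) (φ : (quadDual P).obj (d + 1)),
    U = constantOperation T φ}

/-- The differential `(δ_P U)_A = d_P(U_A)` on families of cochains. -/
noncomputable def familyDiff (P : Operad k) [FiniteDimensional k (P.obj 2)] (d : ℕ) :
    (∀ A : PAlgebra P, Cochains A d) →ₗ[k] (∀ A : PAlgebra P, Cochains A (d + 1)) :=
  LinearMap.pi fun A => cochainDiff A d ∘ₗ LinearMap.proj A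

/-- The complex `(P ⊗ P^!)^Σ_*` in degree `d`. -/
noncomputable abbrev HadamardInv (P : Operad k) (d : ℕ) : Type u :=
  (hadamard P (quadDual P)).signInv (d + 1)

/-- The differential `δ^Σ_χ = [χ, -]` of `(P ⊗ P^!)^Σ_*`. -/
noncomputable def deltaChi (P : Operad k) [FiniteDimensional k (P.obj 2)] (d : ℕ) :
    HadamardInv P d →ₗ[k] HadamardInv P (d + 1) :=
  (hadamard P (quadDual P)).deltaInv (canonicalElement P) d

end NatOp

open NatOp

namespace NatOp

open Equiv (Perm)

variable {k : Type u} [Field k]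

/-! A tree decorated by elements of `P` can already be composed inside `P`. Hence the operation
given by a tree `T` and `φ` takes at every algebra `A` the value of `α ⊗ id` on one universal
element, the average of (composite of `T`) `⊗ φ`. The isomorphism is this observation read
backwards: `cochainFamily` sends an invariant `t` to the family `(α ⊗ id)(t)`, up to a scalar, and
has to be shown bijective onto `natConstants` and compatible with the differentials.

Surjectivity (`range_cochainFamily`): an invariant equals its own average, so averages of pure
tensors `p ⊗ φ` span. An operation `p` of arity at least two is a corolla. In arity one only the
tree without vertices is available a priori, and it suffices because a quadratic operad is spanned
there by its unit (`Operad.IsQuadratic.eq_smul_one`).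

Injectivity (`cochainFamily_injective`): for each arity there is an algebra on which `P` acts
faithfully in that arity (`exists_faithful_algebra`), and tensoring with `P^!(d+1)` over a field
preserves injectivity. The algebra consists of the constants of the operad obtained by repeatedly
adjoining a constant that may be used at most once.

Differentials: `α ⊗ id` is a morphism of operads that carries `χ` to the structure element `D`, so
it intertwines the averaged brackets. The commutator of coderivations is `(d+2)/2` times the
averaged bracket (`cochainDiff_eq`), and the scalars `(d+1)!/2^d` absorb exactly this factor.

Square zero: the averaged product on sign-invariants is graded pre-Lie (`Operad.preLieInv_assoc`),
so `[χ, -]` squares to zero once the pre-Lie square of `χ` vanishes (`Operad.deltaInv_deltaInv`).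
That vanishing is quadratic duality: the three cyclic translates of `χ ∘₁ χ` add up to the canonical
tensor of `(E ⊗ E)³`, `E = P(2)`, pushed to `P(3) ⊗ P^!(3)`, where the second map kills the
annihilator of the kernel of the first (`sum_tmul_dual_eq_zero`). The same fact for the complex of
natural operations is then transported along `cochainFamily`. -/

/-! ## Block permutations -/

/-- `ρ` acts as `σ` on the block of inputs of the inner operation and on the remaining inputs,
and as `τ` inside the block: the relation between the permutations in `Operad.comp_act`. -/
structure IsBlockPerm {m n l : ℕ} (h : m + n = l + 1) (i : Fin m) (σ : Perm (Fin m))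
    (τ : Perm (Fin n)) (ρ : Perm (Fin l)) : Prop where
  inner : ∀ j, ρ (innerSlot h i j) = innerSlot h (σ i) (τ j)
  outer : ∀ a (ha : a ≠ i), ρ (outerSlot h i a ha) =
    outerSlot h (σ i) (σ a) (fun e => ha (σ.injective e))

namespace IsBlockPerm

variable {m n l : ℕ} {h : m + n = l + 1} {i : Fin m}

lemma comp_act (P : Operad k) {σ : Perm (Fin m)} {τ : Perm (Fin n)} {ρ : Perm (Fin l)}
    (H : IsBlockPerm h i σ τ ρ) (p : P.obj m) (q : P.obj n) :
    P.comp h i (P.act σ p) (P.act τ q) = P.act ρ (P.comp h (σ i) p q) :=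
  P.comp_act h i σ τ ρ H.inner H.outer p q

lemma comp_act_left (P : Operad k) {σ : Perm (Fin m)} {ρ : Perm (Fin l)}
    (H : IsBlockPerm h i σ 1 ρ) (p : P.obj m) (q : P.obj n) :
    P.comp h i (P.act σ p) q = P.act ρ (P.comp h (σ i) p q) := by
  rw [← H.comp_act, P.act_one]

lemma comp_act_right (P : Operad k) {τ : Perm (Fin n)} {ρ : Perm (Fin l)}
    (H : IsBlockPerm h i 1 τ ρ) (p : P.obj m) (q : P.obj n) :
    P.comp h i p (P.act τ q) = P.act ρ (P.comp h i p q) := by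
  have := H.comp_act P p q
  rwa [P.act_one] at this

lemma one : IsBlockPerm h i 1 1 1 := ⟨fun _ => rfl, fun _ _ => rfl⟩

lemma mul {σ σ' : Perm (Fin m)} {τ τ' : Perm (Fin n)} {ρ ρ' : Perm (Fin l)}
    (H' : IsBlockPerm h (σ i) σ' τ' ρ') (H : IsBlockPerm h i σ τ ρ) :
    IsBlockPerm h i (σ' * σ) (τ' * τ) (ρ' * ρ) :=
  ⟨fun j => by rw [Equiv.Perm.mul_apply, H.inner, H'.inner]; rfl,
    fun a ha => by
      rw [Equiv.Perm.mul_apply, H.outer, H'.outer _ (fun e => ha (σ.injective e))]; rfl⟩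

lemma inv {σ : Perm (Fin m)} {τ : Perm (Fin n)} {ρ : Perm (Fin l)}
    (H : IsBlockPerm h i σ τ ρ) : IsBlockPerm h (σ i) σ⁻¹ τ⁻¹ ρ⁻¹ := by
  constructor
  · intro j
    obtain ⟨j, rfl⟩ := τ.surjective j
    simp only [Equiv.Perm.inv_eq_iff_eq, perm_inv_apply, H.inner]
  · intro a ha
    obtain ⟨a, rfl⟩ := σ.surjective a
    simp only [Equiv.Perm.inv_eq_iff_eq, perm_inv_apply]
    rw [H.outer _ (fun e => ha (congrArg σ e))]

lemma swap_outer (a b : Fin m) (ha : a ≠ i) (hb : b ≠ i) :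
    IsBlockPerm h i (Equiv.swap a b) (1 : Perm (Fin n))
      (Equiv.swap (outerSlot h i a ha) (outerSlot h i b hb)) := by
  have hi : Equiv.swap a b i = i := Equiv.swap_apply_of_ne_of_ne ha.symm hb.symm
  constructor
  · intro j
    rw [Equiv.swap_apply_of_ne_of_ne (innerSlot_ne_outerSlot _ _ _ _ _)
      (innerSlot_ne_outerSlot _ _ _ _ _)]
    simp [hi]
  · intro c hc
    simp only [hi]
    by_cases h1 : c = a
    · subst h1
      simp
    by_cases h2 : c = b
    · subst h2
      simp
    · rw [Equiv.swap_apply_of_ne_of_ne]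
      · simp [Equiv.swap_apply_of_ne_of_ne h1 h2]
      · rwa [ne_eq, outerSlot_injective]
      · rwa [ne_eq, outerSlot_injective]

lemma swap_inner (a b : Fin n) :
    IsBlockPerm h i 1 (Equiv.swap a b) (Equiv.swap (innerSlot h i a) (innerSlot h i b)) := by
  constructor
  · intro j
    change _ = innerSlot h i _
    by_cases h1 : j = a
    · subst h1
      simp
    by_cases h2 : j = b
    · subst h2
      simp
    · rw [Equiv.swap_apply_of_ne_of_ne, Equiv.swap_apply_of_ne_of_ne h1 h2]
      · rwa [ne_eq, innerSlot_injective]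
      · rwa [ne_eq, innerSlot_injective]
  · intro c hc
    exact Equiv.swap_apply_of_ne_of_ne (innerSlot_ne_outerSlot _ _ _ _ _).symm
      (innerSlot_ne_outerSlot _ _ _ _ _).symm

end IsBlockPerm

/-- Exchanging a block of `n` inputs with the single input to its right is a cycle on `n + 1`
consecutive positions: the block moves up by one and the last position jumps to the front. This is
the only case in which the sign depends on `n`. -/
lemma IsBlockPerm.cycle {n l M : ℕ} {h : M + 1 + n = l + 1} (q : Fin M) :
    IsBlockPerm h q.castSucc (Equiv.swap q.castSucc q.succ) (1 : Perm (Fin n))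
      (Fin.cycleIcc ⟨q.1, by have := q.2; omega⟩ ⟨q.1 + n, by have := q.2; omega⟩) := by
  have hq := q.2
  have : NeZero l := ⟨by omega⟩
  constructor
  · intro j
    have hj := j.2
    rw [Fin.cycleIcc_of_ge_of_lt (by simp [Fin.le_def, innerSlot])
      (by simp [Fin.lt_def, innerSlot])]
    ext
    rw [Fin.val_add_one_of_lt' (by simp [innerSlot]; omega)]
    simp [innerSlot]; omega
  · intro a ha
    have ha1 : a.1 ≠ q.1 := fun e => ha (Fin.ext e)
    have ha2 := a.2
    rcases lt_trichotomy a.1 (q.1 + 1) with h1 | h1 | h1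
    · have h2 : a.1 < q.1 := by omega
      have hs : Equiv.swap q.castSucc q.succ a = a := by
        apply Equiv.swap_apply_of_ne_of_ne ha
        intro e; subst e; simp at h2
      rw [Fin.cycleIcc_of_lt (by simp [Fin.lt_def, outerSlot, h2])]
      ext
      simp [outerSlot, h2, hs, h1]
    · obtain rfl : a = q.succ := Fin.ext (by simpa using h1)
      have e : outerSlot h q.castSucc q.succ ha = ⟨q.1 + n, by omega⟩ := by
        ext; simp [outerSlot]
      rw [e, Fin.cycleIcc_of_last (by simp [Fin.le_def])]
      ext
      simp [outerSlot]
    · have hs : Equiv.swap q.castSucc q.succ a = a := by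
        apply Equiv.swap_apply_of_ne_of_ne ha
        intro e; subst e; simp at h1
      have h2 : ¬ a.1 < q.1 := by omega
      have h3 : ¬ a.1 < q.1 + 1 := by omega
      rw [Fin.cycleIcc_of_gt (by simp [Fin.lt_def, outerSlot, h2]; omega)]
      ext
      simp [outerSlot, h2, hs, h3]

lemma neg_one_pow_units_parity {a b : ℕ} (h : (a + b) % 2 = 0) :
    (-1 : ℤˣ) ^ a = (-1) ^ b :=
  neg_one_pow_congr (by simp only [Nat.even_iff]; omega)

/-- Block permutations exist, and their sign is computed from those of the factors and from the
displacement of the block. -/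
theorem exists_isBlockPerm_left {m n l : ℕ} (h : m + n = l + 1) (σ : Perm (Fin m)) :
    ∀ i : Fin m, ∃ ρ : Perm (Fin l), IsBlockPerm h i σ (1 : Perm (Fin n)) ρ ∧
      Equiv.Perm.sign ρ = Equiv.Perm.sign σ * (-1) ^ ((n + 1) * (i.1 + (σ i).1)) := by
  obtain _ | M := m
  · exact fun i => i.elim0
  -- The sign formula is compatible with products, so it is enough to check it on adjacent
  -- transpositions.
  have hσ : σ ∈ Submonoid.closure
      (Set.range fun i : Fin M => Equiv.swap i.castSucc i.succ) := by
    rw [Equiv.Perm.mclosure_swap_castSucc_succ]; trivial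
  induction hσ using Submonoid.closure_induction with
  | one => exact fun i => ⟨1, .one, by simp [← two_mul, pow_mul]⟩
  | mul σ' σ _ _ H' H =>
    intro i
    obtain ⟨ρ, h1, h2⟩ := H i
    obtain ⟨ρ', h1', h2'⟩ := H' (σ i)
    refine ⟨ρ' * ρ, h1'.mul h1, ?_⟩
    rw [map_mul, map_mul, h2, h2', Equiv.Perm.mul_apply]
    -- The intermediate position `σ i` occurs twice on the right and drops out modulo 2.
    have : (-1 : ℤˣ) ^ ((n + 1) * (i.1 + (σ' (σ i)).1)) =
        (-1) ^ ((n + 1) * ((σ i).1 + (σ' (σ i)).1)) * (-1) ^ ((n + 1) * (i.1 + (σ i).1)) := by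
      rw [← pow_add, ← mul_add]
      simp only [pow_mul']
      congr 1
      exact neg_one_pow_units_parity (by omega)
    rw [this]
    ac_rfl
  | mem σ hσ =>
    obtain ⟨q, rfl⟩ := hσ
    intro i
    have hne : q.castSucc ≠ q.succ := Fin.castSucc_lt_succ.ne
    -- The left side is the sign of a cycle of length `n + 1`; on the right are the sign of the
    -- transposition and the displacement factor. The exponent `n + 1` stands for `n - 1`, which has
    -- the same parity.
    have key : (-1 : ℤˣ) ^ n = -1 * (-1) ^ ((n + 1) * (q.1 + (q.1 + 1))) := by
      rw [← pow_succ']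
      apply neg_one_pow_units_parity
      have : (n + 1) * (q.1 + (q.1 + 1)) = 2 * ((n + 1) * q.1) + (n + 1) := by ring
      omega
    by_cases h1 : i = q.castSucc
    · subst h1
      refine ⟨_, .cycle q, ?_⟩
      rw [Fin.sign_cycleIcc_of_le (by simp [Fin.le_def]), Equiv.Perm.sign_swap hne]
      simpa using key
    by_cases h2 : i = q.succ
    · subst h2
      have := (IsBlockPerm.cycle (h := h) q).inv
      rw [Equiv.swap_inv, Equiv.swap_apply_left, inv_one] at this
      refine ⟨_, this, ?_⟩
      rw [Equiv.Perm.sign_inv, Fin.sign_cycleIcc_of_le (by simp [Fin.le_def]),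
        Equiv.Perm.sign_swap hne]
      simpa [add_comm q.1 1, add_comm (1 + q.1)] using key
    · refine ⟨_, .swap_outer _ _ (Ne.symm h1) (Ne.symm h2), ?_⟩
      rw [Equiv.Perm.sign_swap hne, Equiv.Perm.sign_swap (by rwa [ne_eq, outerSlot_injective]),
        Equiv.swap_apply_of_ne_of_ne h1 h2]
      simp [← two_mul, pow_mul]

theorem exists_isBlockPerm_right {m n l : ℕ} (h : m + n = l + 1) (i : Fin m)
    (τ : Perm (Fin n)) : ∃ ρ : Perm (Fin l), IsBlockPerm h i 1 τ ρ ∧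
      Equiv.Perm.sign ρ = Equiv.Perm.sign τ := by
  induction τ using Equiv.Perm.swap_induction_on with
  | one => exact ⟨1, .one, by simp⟩
  | swap_mul τ a b hab H =>
    obtain ⟨ρ, h1, h2⟩ := H
    refine ⟨_, (IsBlockPerm.swap_inner a b).mul h1, ?_⟩
    rw [map_mul, map_mul, h2, Equiv.Perm.sign_swap hab,
      Equiv.Perm.sign_swap (by rwa [ne_eq, innerSlot_injective])]

theorem exists_isBlockPerm {m n l : ℕ} (h : m + n = l + 1) (i : Fin m) (σ : Perm (Fin m))
    (τ : Perm (Fin n)) : ∃ ρ : Perm (Fin l), IsBlockPerm h i σ τ ρ := by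
  obtain ⟨ρ, h1, -⟩ := exists_isBlockPerm_left (n := n) h σ i
  obtain ⟨ρ', h2, -⟩ := exists_isBlockPerm_right (l := l) h i τ
  exact ⟨_, by simpa using h1.mul (σ := 1) h2⟩

/-! ## Antisymmetrization and the pre-Lie product -/

/-- The sign of a permutation as a scalar. -/
def scalarSign (k : Type u) [Field k] {n : ℕ} (σ : Perm (Fin n)) : k :=
  ((Equiv.Perm.sign σ : ℤˣ) : ℤ)

lemma scalarSign_mul_self {n : ℕ} (σ : Perm (Fin n)) :
    scalarSign k σ * scalarSign k σ = 1 := by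
  rcases Int.units_eq_one_or (Equiv.Perm.sign σ) with h | h <;> simp [scalarSign, h]

lemma sign_zsmul_eq {M : Type*} [AddCommGroup M] [Module k M] {n : ℕ} (σ : Perm (Fin n))
    (x : M) : ((Equiv.Perm.sign σ : ℤˣ) : ℤ) • x = scalarSign k σ • x :=
  (Int.cast_smul_eq_zsmul k _ x).symm

namespace Operad

variable (T : Operad k)

lemma mem_signInv {n : ℕ} {t : T.obj n} :
    t ∈ T.signInv n ↔ ∀ σ : Perm (Fin n), T.act σ t = scalarSign k σ • t := by
  simp only [← sign_zsmul_eq]; rfl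

lemma coe_signSum {n : ℕ} (t : T.obj n) :
    (T.signSum n t : T.obj n) = ∑ σ : Perm (Fin n), scalarSign k σ • T.act σ t := by
  simp only [← sign_zsmul_eq]
  simp [signSum]

lemma signSum_act {n : ℕ} (σ : Perm (Fin n)) (t : T.obj n) :
    T.signSum n (T.act σ t) = scalarSign k σ • T.signSum n t := by
  ext
  rw [Submodule.coe_smul, coe_signSum, coe_signSum, Finset.smul_sum]
  refine Fintype.sum_equiv (Equiv.mulLeft σ) _ _ fun τ => ?_
  rw [Equiv.coe_mulLeft, T.act_mul, smul_smul]
  congr 1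
  simp only [scalarSign, Equiv.Perm.sign_mul, Units.val_mul, Int.cast_mul]
  have := scalarSign_mul_self (k := k) σ
  rw [scalarSign] at this
  rw [← mul_assoc, this, one_mul]

lemma signAver_act {n : ℕ} (σ : Perm (Fin n)) (t : T.obj n) :
    T.signAver n (T.act σ t) = scalarSign k σ • T.signAver n t := by
  simp only [signAver, LinearMap.smul_apply, signSum_act, smul_comm (scalarSign k σ)]

/-- A linear map that is sign-equivariant does not see the antisymmetrization. -/
lemma map_signAver [CharZero k] {n : ℕ} {M : Type*} [AddCommGroup M] [Module k M]
    (L : T.obj n →ₗ[k] M) (t : T.obj n)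
    (hL : ∀ σ : Perm (Fin n), L (T.act σ t) = scalarSign k σ • L t) :
    L (T.signAver n t : T.obj n) = L t := by
  rw [signAver, LinearMap.smul_apply, Submodule.coe_smul, coe_signSum, map_smul, map_sum]
  simp only [map_smul, hL, smul_smul, scalarSign_mul_self, one_smul]
  rw [Finset.sum_const, Finset.card_univ, Fintype.card_perm, Fintype.card_fin,
    ← Nat.cast_smul_eq_nsmul k, smul_smul, inv_mul_cancel₀, one_smul]
  exact_mod_cast n.factorial_ne_zero

lemma signAver_coe [CharZero k] {n : ℕ} (t : T.signInv n) :
    T.signAver n (t : T.obj n) = t := by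
  ext
  exact T.map_signAver LinearMap.id t.1 ((T.mem_signInv).1 t.2)

lemma preLie_apply {m n l : ℕ} (h : m + n = l + 1) (p : T.obj m) (q : T.obj n) :
    T.preLie h p q = ∑ i : Fin m, (-1 : k) ^ ((n + 1) * i.1) • T.comp h i p q := by
  simp [preLie]

lemma exists_comp_act_left {m n l : ℕ} (h : m + n = l + 1) (i : Fin m) (σ : Perm (Fin m)) :
    ∃ ρ : Perm (Fin l), scalarSign k ρ = scalarSign k σ * (-1) ^ ((n + 1) * (i.1 + (σ i).1)) ∧
      ∀ (p : T.obj m) (q : T.obj n),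
        T.comp h i (T.act σ p) q = T.act ρ (T.comp h (σ i) p q) := by
  obtain ⟨ρ, h1, h2⟩ := exists_isBlockPerm_left h σ i
  refine ⟨ρ, ?_, h1.comp_act_left T⟩
  simp only [scalarSign, h2]
  push_cast
  rfl

lemma exists_comp_act_right {m n l : ℕ} (h : m + n = l + 1) (i : Fin m) (τ : Perm (Fin n)) :
    ∃ ρ : Perm (Fin l), scalarSign k ρ = scalarSign k τ ∧
      ∀ (p : T.obj m) (q : T.obj n),
        T.comp h i p (T.act τ q) = T.act ρ (T.comp h i p q) := by
  obtain ⟨ρ, h1, h2⟩ := exists_isBlockPerm_right h i τ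
  exact ⟨ρ, by simp only [scalarSign, h2], h1.comp_act_right T⟩

/-- For a sign-invariant `p` all inputs are equivalent: the transposition of `0` and `i` changes `p`
only by a sign, and the block permutation that it induces has the sign of the transposition times
`(-1)^((n+1)i)`. Thus the signs in `preLie` make all its summands equal after averaging. -/
lemma signAver_comp_of_mem {m n l : ℕ} (h : m + 1 + n = l + 1) (i : Fin (m + 1))
    {p : T.obj (m + 1)} (hp : p ∈ T.signInv (m + 1)) (q : T.obj n) :
    (-1 : k) ^ ((n + 1) * i.1) • T.signAver l (T.comp h i p q) =
      T.signAver l (T.comp h 0 p q) := by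
  obtain ⟨ρ, h1, h2⟩ := T.exists_comp_act_left h 0 (Equiv.swap 0 i)
  specialize h2 p q
  rw [(T.mem_signInv).1 hp, Equiv.swap_apply_left, map_smul, LinearMap.smul_apply] at h2
  have h3 := congrArg (fun x => scalarSign k (Equiv.swap 0 i) • T.signAver l x) h2
  simp only [map_smul, smul_smul, signAver_act, scalarSign_mul_self, one_smul, h1] at h3
  rw [h3, ← mul_assoc, scalarSign_mul_self, one_mul, Equiv.swap_apply_left]
  simp

lemma signAver_preLie_of_mem {m n l : ℕ} (h : m + 1 + n = l + 1)
    {p : T.obj (m + 1)} (hp : p ∈ T.signInv (m + 1)) (q : T.obj n) :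
    T.signAver l (T.preLie h p q) = ((m + 1 : ℕ) : k) • T.signAver l (T.comp h 0 p q) := by
  rw [preLie_apply, map_sum]
  simp only [map_smul, T.signAver_comp_of_mem h _ hp]
  rw [Finset.sum_const, Finset.card_univ, Fintype.card_fin, Nat.cast_smul_eq_nsmul]

/-- The block permutation sign cancels against the change of the coefficient when the sum is
reindexed by `σ`. With the analogue for the second argument this shows, through `map_signAver`, that
the averaged product depends only on the averages of its arguments, so inner averages may be dropped
from iterated products. -/
lemma signAver_preLie_act_left {m n l : ℕ} (h : m + n = l + 1) (σ : Perm (Fin m))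
    (p : T.obj m) (q : T.obj n) :
    T.signAver l (T.preLie h (T.act σ p) q) =
      scalarSign k σ • T.signAver l (T.preLie h p q) := by
  simp only [preLie_apply, map_sum, Finset.smul_sum]
  refine Fintype.sum_equiv σ _ _ fun i => ?_
  obtain ⟨ρ, h1, h2⟩ := T.exists_comp_act_left h i σ
  rw [h2, map_smul, map_smul, signAver_act, h1, smul_smul, smul_smul, mul_left_comm, ← pow_add]
  congr 2
  exact neg_one_pow_congr (by
    simp only [← mul_add, Nat.even_mul, Nat.even_add]; tauto)

lemma signAver_preLie_act_right {m n l : ℕ} (h : m + n = l + 1) (τ : Perm (Fin n))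
    (p : T.obj m) (q : T.obj n) :
    T.signAver l (T.preLie h p (T.act τ q)) =
      scalarSign k τ • T.signAver l (T.preLie h p q) := by
  simp only [preLie_apply, map_sum, Finset.smul_sum]
  refine Finset.sum_congr rfl fun i _ => ?_
  obtain ⟨ρ, h1, h2⟩ := T.exists_comp_act_right h i τ
  rw [h2, map_smul, map_smul, signAver_act, h1, smul_comm]

variable [CharZero k]

lemma signAver_preLie_signAver_left {m n l : ℕ} (h : m + n = l + 1) (p : T.obj m)
    (q : T.obj n) : T.signAver l (T.preLie h (T.signAver m p : T.obj m) q) =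
      T.signAver l (T.preLie h p q) :=
  T.map_signAver (T.signAver l ∘ₗ (T.preLie h).flip q) p fun σ =>
    T.signAver_preLie_act_left h σ p q

lemma signAver_preLie_signAver_right {m n l : ℕ} (h : m + n = l + 1) (p : T.obj m)
    (q : T.obj n) : T.signAver l (T.preLie h p (T.signAver n q : T.obj n)) =
      T.signAver l (T.preLie h p q) :=
  T.map_signAver (T.signAver l ∘ₗ T.preLie h p) q fun σ =>
    T.signAver_preLie_act_right h σ p q


end Operad

/-! ### The pre-Lie identity and differentials from square-zero elements. -/

/-- The inputs of `p ∘ᵢ q` are those of `q` and those of `p` other than `i`. -/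
noncomputable def slotEquiv {m n l : ℕ} (h : m + n = l + 1) (i : Fin m) :
    Fin n ⊕ {a : Fin m // a ≠ i} ≃ Fin l :=
  Equiv.ofBijective
    (Sum.elim (innerSlot h i) fun a => outerSlot h i a.1 a.2) <| by
      constructor
      · rintro (j | ⟨a, ha⟩) (j' | ⟨a', ha'⟩) e
        · exact congrArg _ ((innerSlot_injective h i _ _).1 e)
        · exact (innerSlot_ne_outerSlot h i a' ha' _ e).elim
        · exact (innerSlot_ne_outerSlot h i a ha _ e.symm).elim
        · exact congrArg _ (Subtype.ext ((outerSlot_injective h i a a' ha ha').1 e))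
      · intro x
        rcases slot_cases h i x with ⟨j, rfl⟩ | ⟨a, ha, rfl⟩
        · exact ⟨.inl j, rfl⟩
        · exact ⟨.inr ⟨a, ha⟩, rfl⟩

lemma sum_slots {M : Type*} [AddCommMonoid M] {m n l : ℕ} (h : m + n = l + 1) (i : Fin m)
    (F : Fin l → M) : ∑ x, F x = ∑ j, F (innerSlot h i j) +
      ∑ a : {a : Fin m // a ≠ i}, F (outerSlot h i a.1 a.2) := by
  rw [← (slotEquiv h i).sum_comp, Fintype.sum_sum_type]
  rfl

/-- Exchanging the two indices in a sum over pairs of distinct indices. -/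
lemma sum_ne_comm {M : Type*} [AddCommMonoid M] {m : ℕ}
    (F : ∀ i a : Fin m, a ≠ i → M) :
    ∑ i, ∑ a : {a : Fin m // a ≠ i}, F i a.1 a.2 =
      ∑ i, ∑ a : {a : Fin m // a ≠ i}, F a.1 i a.2.symm := by
  rw [← Fintype.sum_sigma', ← Fintype.sum_sigma']
  let e : (Σ i : Fin m, {a : Fin m // a ≠ i}) → Σ i : Fin m, {a : Fin m // a ≠ i} :=
    fun x => ⟨x.2.1, x.1, x.2.2.symm⟩
  have he : Function.Involutive e := fun _ => rfl
  exact Fintype.sum_bijective e he.bijective _ _ fun _ => rfl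

namespace Operad

variable (T : Operad k)

/-- The part of `(p ∘ q) ∘ x` in which `x` is inserted into an input of `p`. -/
def preLieOuter {m n r l t : ℕ} (h₁ : m + n = l + 1) (h₂ : l + r = t + 1) (p : T.obj m)
    (q : T.obj n) (x : T.obj r) : T.obj t :=
  ∑ i : Fin m, ∑ a : {a : Fin m // a ≠ i},
    (-1 : k) ^ ((n + 1) * i.1 + (r + 1) * (outerSlot h₁ i a.1 a.2).1) •
      T.comp h₂ (outerSlot h₁ i a.1 a.2) (T.comp h₁ i p q) x

/-- An input of `p ∘ᵢ q` belongs to `q` or to `p`. The first kind assembles to `p ∘ (q ∘ x)` by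
sequential associativity, so the associator is the outer part. -/
lemma preLie_preLie {m n r l s t : ℕ} (h₁ : m + n = l + 1) (h₂ : l + r = t + 1)
    (h₃ : n + r = s + 1) (h₄ : m + s = t + 1) (p : T.obj m) (q : T.obj n) (x : T.obj r) :
    T.preLie h₂ (T.preLie h₁ p q) x =
      T.preLie h₄ p (T.preLie h₃ q x) + T.preLieOuter h₁ h₂ p q x := by
  have e : T.preLie h₂ (T.preLie h₁ p q) x = ∑ i : Fin m, ∑ y : Fin l,
      (-1 : k) ^ ((n + 1) * i.1 + (r + 1) * y.1) • T.comp h₂ y (T.comp h₁ i p q) x := by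
    simp only [preLie_apply, map_sum, LinearMap.sum_apply, map_smul, LinearMap.smul_apply,
      Finset.smul_sum, smul_smul, pow_add]
  rw [e, preLieOuter, preLie_apply, ← Finset.sum_add_distrib]
  refine Finset.sum_congr rfl fun i _ => ?_
  rw [sum_slots h₁ i, preLie_apply, map_sum, Finset.smul_sum]
  congr 1
  refine Finset.sum_congr rfl fun j _ => ?_
  rw [T.comp_comp_inner h₁ h₂ h₃ h₄, map_smul, smul_smul, ← pow_add]
  congr 1
  refine neg_one_pow_congr ?_
  -- Degrees add: `s - 1 = (n - 1) + (r - 1)`, written without subtraction. This turns the sign of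
  -- inserting at position `i + j` into the product of the signs of the two nested insertions.
  have h5 : (s + 1) + 2 = (n + 1) + (r + 1) := by omega
  have h6 : (n + 1) * i.1 + (r + 1) * (innerSlot h₁ i j).1 =
      (s + 1) * i.1 + (r + 1) * j.1 + 2 * i.1 := by
    have : (innerSlot h₁ i j).1 = i.1 + j.1 := rfl
    rw [this]
    zify at h5 ⊢
    linear_combination (-i.1 : ℤ) * h5
  rw [h6]
  simp [Nat.even_add]

/-- Insertions into two distinct inputs of `p` commute, so only signs are at stake. The insertion
further left shifts the position of the other one by its arity minus one, and in either order of the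
inputs this shift produces the Koszul sign. -/
lemma preLieOuter_comm {m n r l s t : ℕ} (h₁ : m + n = l + 1) (h₂ : l + r = t + 1)
    (h₃ : m + r = s + 1) (h₄ : s + n = t + 1) (p : T.obj m) (q : T.obj n) (x : T.obj r) :
    T.preLieOuter h₁ h₂ p q x =
      (-1 : k) ^ ((n + 1) * (r + 1)) • T.preLieOuter h₃ h₄ p x q := by
  rw [preLieOuter, preLieOuter, sum_ne_comm (fun i a ha =>
    (-1 : k) ^ ((n + 1) * i.1 + (r + 1) * (outerSlot h₁ i a ha).1) •
      T.comp h₂ (outerSlot h₁ i a ha) (T.comp h₁ i p q) x), Finset.smul_sum]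
  refine Finset.sum_congr rfl fun a _ => ?_
  rw [Finset.smul_sum]
  refine Finset.sum_congr rfl fun ⟨i, hi⟩ _ => ?_
  rw [smul_smul, ← pow_add, T.comp_comp_outer h₁ h₂ h₃ h₄ i a hi.symm]
  congr 1
  refine neg_one_pow_congr ?_
  have h5 : a.1 ≠ i.1 := fun e => hi (Fin.ext e.symm)
  rcases lt_or_gt_of_ne h5 with h6 | h6
  · have e1 : (outerSlot h₁ i a hi.symm).1 = a.1 := by simp [outerSlot, h6]
    have e2 : (outerSlot h₃ a i hi).1 + 1 = i.1 + r := by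
      have : ¬ i.1 < a.1 := by omega
      simp only [outerSlot, this, if_false]; omega
    have e3 : (n + 1) * (r + 1) + ((r + 1) * a.1 + (n + 1) * (outerSlot h₃ a i hi).1) =
        (n + 1) * i.1 + (r + 1) * a.1 + 2 * ((n + 1) * r) := by
      zify at e2 ⊢
      linear_combination (n + 1 : ℤ) * e2
    rw [e1, e3]
    simp [Nat.even_add]
  · have e1 : (outerSlot h₃ a i hi).1 = i.1 := by simp [outerSlot, h6]
    have e2 : (outerSlot h₁ i a hi.symm).1 + 1 = a.1 + n := by
      have : ¬ a.1 < i.1 := by omega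
      simp only [outerSlot, this, if_false]; omega
    have e3 : (n + 1) * i.1 + (r + 1) * (outerSlot h₁ i a hi.symm).1 + 2 * (r + 1) =
        (n + 1) * (r + 1) + ((r + 1) * a.1 + (n + 1) * i.1) := by
      zify at e2 ⊢
      linear_combination (r + 1 : ℤ) * e2
    rw [e1, ← e3]
    simp [Nat.even_add]

/-- The pre-Lie product on invariants: the class of `p ∘ q`. -/
noncomputable def preLieInv {m n l : ℕ} (h : m + n = l + 1) :
    T.signInv m →ₗ[k] T.signInv n →ₗ[k] T.signInv l :=
  ((T.preLie h).compr₂ (T.signAver l)).domRestrict₁₂ (T.signInv m) (T.signInv n)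

lemma preLieInv_apply {m n l : ℕ} (h : m + n = l + 1) (p : T.signInv m) (q : T.signInv n) :
    T.preLieInv h p q = T.signAver l (T.preLie h p.1 q.1) := rfl

lemma bracketInv_apply {m n l : ℕ} (h : m + n = l + 1) (p : T.signInv m) (q : T.signInv n) :
    T.bracketInv h p q = T.preLieInv h p q -
      (-1 : k) ^ ((m + 1) * (n + 1)) • T.preLieInv ((add_comm n m).trans h) q p := by
  change T.signAver l (T.preLie h p.1 q.1 - (-1 : k) ^ ((m + 1) * (n + 1)) •
    T.preLie ((add_comm n m).trans h) q.1 p.1) = _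
  rw [map_sub, map_smul]
  rfl

lemma deltaInv_apply (φ : T.signInv 2) (d : ℕ) (t : T.signInv (d + 1)) :
    T.deltaInv φ d t = T.preLieInv (by omega : 2 + (d + 1) = d + 2 + 1) φ t -
      (-1 : k) ^ d • T.preLieInv (by omega : d + 1 + 2 = d + 2 + 1) t φ := by
  rw [deltaInv, bracketInv_apply]
  congr 2
  exact neg_one_pow_congr (by simp [Nat.even_add_one, parity_simps])

variable [CharZero k]

/-- The pre-Lie identity on invariants. -/
theorem preLieInv_assoc {m n r l l' s s' t : ℕ} (h₁ : m + n = l + 1) (h₂ : l + r = t + 1)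
    (h₃ : n + r = s + 1) (h₄ : m + s = t + 1) (h₁' : m + r = l' + 1) (h₂' : l' + n = t + 1)
    (h₃' : r + n = s' + 1) (h₄' : m + s' = t + 1)
    (p : T.signInv m) (q : T.signInv n) (x : T.signInv r) :
    T.preLieInv h₂ (T.preLieInv h₁ p q) x - T.preLieInv h₄ p (T.preLieInv h₃ q x) =
      (-1 : k) ^ ((n + 1) * (r + 1)) • (T.preLieInv h₂' (T.preLieInv h₁' p x) q -
        T.preLieInv h₄' p (T.preLieInv h₃' x q)) := by
  simp only [preLieInv_apply, signAver_preLie_signAver_left, signAver_preLie_signAver_right]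
  rw [T.preLie_preLie h₁ h₂ h₃ h₄, T.preLie_preLie h₁' h₂' h₃' h₄', map_add, map_add,
    add_sub_cancel_left, add_sub_cancel_left, T.preLieOuter_comm h₁ h₂ h₁' h₂', map_smul]

/-- Two instances of the pre-Lie identity suffice, without the Jacobi identity. Writing `⋆` for the
product, the triple `(φ, φ, t)` expresses `φ ⋆ (φ ⋆ t)` through the mixed terms `(φ ⋆ t) ⋆ φ` and `φ
⋆ (t ⋆ φ)`, while `(t, φ, φ)` removes `(t ⋆ φ) ⋆ φ`. -/
theorem deltaInv_deltaInv (φ : T.signInv 2)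
    (hφ : T.preLieInv (rfl : 2 + 2 = 3 + 1) φ φ = 0) (d : ℕ) (t : T.signInv (d + 1)) :
    T.deltaInv φ (d + 1) (T.deltaInv φ d t) = 0 := by
  have e1 := T.preLieInv_assoc (rfl : 2 + 2 = 3 + 1) (by omega : 3 + (d + 1) = d + 3 + 1)
    (by omega : 2 + (d + 1) = d + 2 + 1) (by omega : 2 + (d + 2) = d + 3 + 1)
    (by omega : 2 + (d + 1) = d + 2 + 1) (by omega : d + 2 + 2 = d + 3 + 1)
    (by omega : d + 1 + 2 = d + 2 + 1) (by omega : 2 + (d + 2) = d + 3 + 1) φ φ t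
  have e2 := T.preLieInv_assoc (by omega : d + 1 + 2 = d + 2 + 1)
    (by omega : d + 2 + 2 = d + 3 + 1) (rfl : 2 + 2 = 3 + 1)
    (by omega : d + 1 + 3 = d + 3 + 1) (by omega : d + 1 + 2 = d + 2 + 1)
    (by omega : d + 2 + 2 = d + 3 + 1) (rfl : 2 + 2 = 3 + 1)
    (by omega : d + 1 + 3 = d + 3 + 1) t φ φ
  have hd : (-1 : k) ^ ((2 + 1) * (d + 1 + 1)) = (-1) ^ d :=
    neg_one_pow_congr (by simp [Nat.even_add_one, parity_simps])
  rw [hφ, map_zero, LinearMap.zero_apply, zero_sub, hd] at e1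
  rw [hφ, map_zero, sub_zero] at e2
  -- The associator of `(t, φ, φ)` is antisymmetric in the two equal elements of odd degree, hence
  -- equal to its own negative; here characteristic different from two is used.
  have e3 : T.preLieInv (by omega : d + 2 + 2 = d + 3 + 1)
      (T.preLieInv (by omega : d + 1 + 2 = d + 2 + 1) t φ) φ = 0 := by
    have : (2 : k) • T.preLieInv (by omega : d + 2 + 2 = d + 3 + 1)
      (T.preLieInv (by omega : d + 1 + 2 = d + 2 + 1) t φ) φ = 0 := by
      rw [two_smul]
      nth_rewrite 1 [e2]
      norm_num
    exact (smul_eq_zero.1 this).resolve_left two_ne_zero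
  rw [deltaInv_apply, deltaInv_apply]
  simp only [map_sub, map_smul, LinearMap.sub_apply, LinearMap.smul_apply, e3, smul_zero,
    sub_zero]
  rw [neg_eq_iff_eq_neg] at e1
  rw [e1, pow_succ, smul_sub]
  module

end Operad

/-! ## The canonical element is a Maurer–Cartan element -/

/-- If `g` kills the annihilator of the kernel of `f`, then `f ⊗ g` kills the element that
corresponds to the identity. -/
lemma sum_tmul_dual_eq_zero {ι V W X Y : Type*} [Fintype ι] [AddCommGroup V] [Module k V]
    [AddCommGroup W] [Module k W] [AddCommGroup X] [Module k X] [AddCommGroup Y] [Module k Y]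
    (b : Module.Basis ι k V) (w : ι → W) (B : W →ₗ[k] Module.Dual k V)
    (hw : ∀ s, B (w s) = b.coord s) (f : V →ₗ[k] X) (g : W →ₗ[k] Y)
    (hg : ∀ ξ, (∀ r ∈ LinearMap.ker f, B ξ r = 0) → g ξ = 0) :
    ∑ s, f (b s) ⊗ₜ[k] g (w s) = 0 := by
  -- With `e` a section of `f` onto its range, `π = e ∘ f` is a projection with `f ∘ π = f` that
  -- kills `ker f`. Replacing `b s` by `π (b s)` in the first factor and moving the coefficients to
  -- the second one turns the dual basis into the functionals `b.coord t ∘ π`.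
  obtain ⟨e, he⟩ := f.rangeRestrict.exists_rightInverse_of_surjective f.range_rangeRestrict
  set π : V →ₗ[k] V := e ∘ₗ f.rangeRestrict with hπ
  have h1 : ∀ v, f (π v) = f v := fun v =>
    congrArg Subtype.val (LinearMap.congr_fun he (f.rangeRestrict v))
  have h2 : ∀ r ∈ LinearMap.ker f, π r = 0 := by
    intro r hr
    have : f.rangeRestrict r = 0 := Subtype.ext (by simpa using hr)
    rw [hπ, LinearMap.comp_apply, this, map_zero]
  have h3 : ∀ s, f (b s) = ∑ t, b.coord t (π (b s)) • f (b t) := by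
    intro s
    conv_lhs => rw [← h1, ← b.sum_repr (π (b s)), map_sum]
    simp
  rw [Finset.sum_congr rfl fun s _ => congrArg (· ⊗ₜ[k] g (w s)) (h3 s)]
  simp only [TensorProduct.sum_tmul, TensorProduct.smul_tmul]
  rw [Finset.sum_comm]
  refine Finset.sum_eq_zero fun t _ => ?_
  rw [← TensorProduct.tmul_sum]
  simp only [← map_smul, ← map_sum]
  rw [hg, TensorProduct.tmul_zero]
  -- The functional represented by the second factor is `b.coord t ∘ π`, which vanishes on `ker f`;
  -- this is the hypothesis under which `g` gives zero.
  intro r hr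
  have h4 : b.coord t (π r) = 0 := by rw [h2 r hr, map_zero]
  rw [← h4]
  conv_rhs => rw [← b.sum_repr r, map_sum, map_sum]
  simp [hw, mul_comm]

lemma homToTensor_eq_sum (P : Operad k) [FiniteDimensional k (P.obj 2)] {W : Type u}
    [AddCommGroup W] [Module k W] (φ : P.obj 2 →ₗ[k] W) {ι : Type*} [Fintype ι]
    (b : Module.Basis ι k (P.obj 2)) :
    homToTensor P φ = ∑ a, φ (b a) ⊗ₜ[k] dualGen P (b.coord a) := by
  classical
  have : (dualTensorHomEquiv k (P.obj 2) W).symm φ = ∑ a, b.coord a ⊗ₜ[k] φ (b a) := by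
    rw [LinearEquiv.symm_apply_eq]
    change φ = dualTensorHom k _ _ _
    refine b.ext fun c => ?_
    rw [map_sum, LinearMap.sum_apply]
    simp only [dualTensorHom_apply, Module.Basis.coord_apply, b.repr_self,
      Finsupp.single_apply, ite_smul, one_smul, zero_smul]
    simp
  rw [homToTensor, this]
  simp

lemma cubicMap_single {V : Type u} [AddCommGroup V] [Module k V] (Q : Operad k)
    (g : V →ₗ[k] Q.obj 2) (j : Fin 3) (x y : V) :
    cubicMap Q g (Pi.single j (x ⊗ₜ[k] y)) =
      Q.act (finRotate 3 ^ j.1) (Q.comp (rfl : 2 + 2 = 3 + 1) 0 (g x) (g y)) := by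
  rw [cubicMap, LinearMap.sum_apply, Finset.sum_eq_single j]
  · simp
  · intro i _ hi
    simp [Pi.single_eq_of_ne hi]
  · simp

lemma cubicMap_map {V : Type u} [AddCommGroup V] [Module k V] {Q S : Operad k}
    (F : OperadHom Q S) (g : V →ₗ[k] Q.obj 2) (ξ : Fin 3 → V ⊗[k] V) :
    F.map 3 (cubicMap Q g ξ) = cubicMap S (F.map 2 ∘ₗ g) ξ := by
  have : F.map 3 ∘ₗ cubicMap Q g = cubicMap S (F.map 2 ∘ₗ g) := by
    ext j x y
    simp only [LinearMap.comp_apply, TensorProduct.AlgebraTensorModule.curry_apply,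
      TensorProduct.curry_apply, LinearMap.coe_restrictScalars, LinearMap.coe_single,
      cubicMap_single, F.map_act, F.map_comp]
  exact LinearMap.congr_fun this ξ

lemma cubicMap_quadDual (P : Operad k)
    (ξ : Fin 3 → Module.Dual k (P.obj 2) ⊗[k] Module.Dual k (P.obj 2))
    (hξ : ξ ∈ dualRelations P) : cubicMap (quadDual P) (dualGen P) ξ = 0 := by
  have h := cubicMap_map (quotientProj _ (dualIdeal P)) (dualFreeGen P) ξ
  refine h.symm.trans ?_
  refine (Submodule.Quotient.mk_eq_zero _).2 ?_
  change _ ∈ ⨅ I : {I : OperadIdeal _ // _}, _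
  rw [Submodule.mem_iInf]
  exact fun I => I.2 (Submodule.mem_map_of_mem hξ)

/-- The pairing of `(E^# ⊗ E^#)³` with `(E ⊗ E)³`. -/
noncomputable def cubicPairing (k : Type u) [Field k] (E : Type u) [AddCommGroup E]
    [Module k E] : (Fin 3 → Module.Dual k E ⊗[k] Module.Dual k E) →ₗ[k]
      Module.Dual k (Fin 3 → E ⊗[k] E) :=
  ∑ j, (LinearMap.proj (R := k) (φ := fun _ : Fin 3 => E ⊗[k] E) j).dualMap ∘ₗ
    TensorProduct.dualDistrib k E E ∘ₗ LinearMap.proj j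

lemma cubicPairing_apply (E : Type u) [AddCommGroup E] [Module k E]
    (ξ : Fin 3 → Module.Dual k E ⊗[k] Module.Dual k E) (r : Fin 3 → E ⊗[k] E) :
    cubicPairing k E ξ r = ∑ j, TensorProduct.dualDistrib k E E (ξ j) (r j) := by
  simp [cubicPairing]

/-- This is where quadratic duality enters. In a basis of `P(2)` the sum becomes `∑ f(b s) ⊗ g(w
s)`, with `b` the induced basis of `(E ⊗ E)³`, `w` its dual family, and `f`, `g` the maps `cubicMap`
to `P(3)` and `P^!(3)`. The kernel of `f` is the space of relations of `P`, and `g` vanishes on its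
annihilator by construction of `P^!`. -/
lemma sum_act_comp_canonicalElement (P : Operad k) [FiniteDimensional k (P.obj 2)] :
    ∑ j : Fin 3, (hadamard P (quadDual P)).act (finRotate 3 ^ j.1)
      ((hadamard P (quadDual P)).comp (rfl : 2 + 2 = 3 + 1) 0 (canonicalElement P).1
        (canonicalElement P).1) = 0 := by
  classical
  set b := Module.finBasis k (P.obj 2)
  have hχ : (canonicalElement P).1 = ∑ a, b a ⊗ₜ[k] dualGen P (b.coord a) :=
    homToTensor_eq_sum P LinearMap.id b
  have key := sum_tmul_dual_eq_zero (Pi.basis fun _ : Fin 3 => b.tensorProduct b)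
    (fun s => Pi.single s.1 (b.coord s.2.1 ⊗ₜ[k] b.coord s.2.2)) (cubicPairing k (P.obj 2))
    (fun s => by
      refine (Pi.basis fun _ : Fin 3 => b.tensorProduct b).ext fun t => ?_
      obtain ⟨j, a, c⟩ := s
      obtain ⟨j', a', c'⟩ := t
      rw [cubicPairing_apply, Module.Basis.coord_apply, Module.Basis.repr_self, Pi.basis_apply,
        Finset.sum_eq_single j]
      · by_cases hj : j' = j
        · subst hj
          simp only [Pi.single_eq_same, Module.Basis.tensorProduct_apply,
            TensorProduct.dualDistrib_apply, Module.Basis.coord_apply, Module.Basis.repr_self,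
            Finsupp.single_apply]
          by_cases h1 : a' = a <;> by_cases h2 : c' = c <;> simp [h1, h2]
        · rw [Pi.single_eq_of_ne (Ne.symm hj), map_zero, Finsupp.single_apply, if_neg]
          intro e
          exact hj (congrArg Sigma.fst e)
      · intro i _ hi
        simp [Pi.single_eq_of_ne hi]
      · simp)
    (cubicMap P LinearMap.id) (cubicMap (quadDual P) (dualGen P))
    (fun ξ hξ => cubicMap_quadDual P ξ fun r hr => by
      rw [← cubicPairing_apply]; exact hξ r hr)
  refine Eq.trans ?_ key
  rw [Fintype.sum_sigma]
  refine Finset.sum_congr rfl fun j _ => ?_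
  rw [Fintype.sum_prod_type, hχ]
  change TensorProduct.map (P.act _) ((quadDual P).act _)
    (TensorProduct.map₂ (P.comp _ 0) ((quadDual P).comp _ 0) _ _) = _
  simp only [map_sum, LinearMap.sum_apply, TensorProduct.map₂_apply_tmul,
    TensorProduct.map_tmul, Pi.basis_apply, Module.Basis.tensorProduct_apply, cubicMap_single,
    LinearMap.id_apply]
  exact Finset.sum_comm

lemma sign_finRotate_three_pow (j : Fin 3) :
    Equiv.Perm.sign (finRotate 3 ^ j.1) = 1 := by
  rw [map_pow, sign_finRotate]; simp

/-- Powers of the 3-cycle are even, so the three translates of `χ ∘₁ χ` have the same average, and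
three times it is zero. The two summands of `χ ∘ χ` have this same average up to the signs of
`preLie`. -/
theorem preLieInv_canonicalElement [CharZero k] (P : Operad k)
    [FiniteDimensional k (P.obj 2)] :
    (hadamard P (quadDual P)).preLieInv (rfl : 2 + 2 = 3 + 1) (canonicalElement P)
      (canonicalElement P) = 0 := by
  have h := congrArg ((hadamard P (quadDual P)).signAver 3) (sum_act_comp_canonicalElement P)
  simp only [map_sum, map_zero, Operad.signAver_act, scalarSign, sign_finRotate_three_pow,
    Units.val_one, Int.cast_one, one_smul, Finset.sum_const, Finset.card_univ,
    Fintype.card_fin] at h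
  rw [Operad.preLieInv_apply,
    Operad.signAver_preLie_of_mem _ (rfl : 1 + 1 + 2 = 3 + 1) (canonicalElement P).2]
  rw [← Nat.cast_smul_eq_nsmul k, smul_eq_zero] at h
  rw [h.resolve_left (by norm_num), smul_zero]

theorem bracketInv_canonicalElement [CharZero k] (P : Operad k)
    [FiniteDimensional k (P.obj 2)] :
    (hadamard P (quadDual P)).bracketInv (rfl : 2 + 2 = 3 + 1) (canonicalElement P)
      (canonicalElement P) = 0 := by
  rw [Operad.bracketInv_apply, preLieInv_canonicalElement, smul_zero, sub_zero]

/-! ## The operadic cochain complex and morphisms of operads -/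

namespace OperadHom

variable {S T : Operad k} (f : OperadHom S T)

lemma coe_mapInv {n : ℕ} (t : S.signInv n) : (f.mapInv n t : T.obj n) = f.map n t := rfl

lemma mapInv_signAver {n : ℕ} (t : S.obj n) :
    f.mapInv n (S.signAver n t) = T.signAver n (f.map n t) := by
  ext
  simp only [coe_mapInv, Operad.signAver, LinearMap.smul_apply, Submodule.coe_smul,
    Operad.coe_signSum, map_smul, map_sum, f.map_act]

lemma mapInv_preLieInv {m n l : ℕ} (h : m + n = l + 1) (p : S.signInv m) (q : S.signInv n) :
    f.mapInv l (S.preLieInv h p q) = T.preLieInv h (f.mapInv m p) (f.mapInv n q) := by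
  rw [Operad.preLieInv_apply, mapInv_signAver, Operad.preLieInv_apply]
  simp only [Operad.preLie_apply, map_sum, map_smul, f.map_comp, coe_mapInv]

lemma mapInv_deltaInv (φ : S.signInv 2) (d : ℕ) (t : S.signInv (d + 1)) :
    f.mapInv (d + 2) (S.deltaInv φ d t) =
      T.deltaInv (f.mapInv 2 φ) d (f.mapInv (d + 1) t) := by
  simp only [Operad.deltaInv_apply, map_sub, map_smul, mapInv_preLieInv]

end OperadHom

lemma factorial_cast_ne_zero [CharZero k] (n : ℕ) : (n.factorial : k) ≠ 0 := by
  exact_mod_cast n.factorial_ne_zero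

/-- Averaging contributes `l!`, and passing from the single insertion to the full sum over inputs
divides by `m + 1`. The resulting coefficient is symmetric in the arities `m + 1` and `n` of the two
factors, which is why a commutator of coderivations is a multiple of the bracket. -/
lemma Operad.coderComp_eq [CharZero k] (T : Operad k) {m n l : ℕ} (h : m + 1 + n = l + 1)
    (p : T.signInv (m + 1)) (q : T.signInv n) :
    T.coderComp h p.1 q.1 = ((l.factorial : k) / (n.factorial * (m + 1).factorial)) •
      T.preLieInv h p q := by
  have h1 : T.signSum l (T.comp h 0 p.1 q.1) =
      (l.factorial : k) • T.signAver l (T.comp h 0 p.1 q.1) := by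
    rw [signAver, LinearMap.smul_apply, smul_smul, mul_inv_cancel₀ (factorial_cast_ne_zero l),
      one_smul]
  change ((n.factorial : k) * m.factorial)⁻¹ • T.signSum l (T.comp h 0 p.1 q.1) = _
  rw [h1, preLieInv_apply, T.signAver_preLie_of_mem h p.2, smul_smul, smul_smul]
  congr 1
  have := factorial_cast_ne_zero (k := k) m
  have := factorial_cast_ne_zero (k := k) n
  have : ((m + 1 : ℕ) : k) ≠ 0 := Nat.cast_ne_zero.2 m.succ_ne_zero
  rw [Nat.factorial_succ, Nat.cast_mul]
  field_simp

lemma structureElement_eq {P : Operad k} [FiniteDimensional k (P.obj 2)] (A : PAlgebra P) :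
    structureElement A =
      (hadamardHom A.action (OperadHom.id (quadDual P))).mapInv 2 (canonicalElement P) := by
  ext
  have b := Module.finBasis k (P.obj 2)
  change homToTensor P (A.action.map 2) =
    TensorProduct.map (A.action.map 2) LinearMap.id (homToTensor P LinearMap.id)
  rw [homToTensor_eq_sum P _ b, homToTensor_eq_sum P _ b, map_sum]
  simp

/-- Both terms of the commutator carry the coefficient `(d+2)!/(2!(d+1)!) = (d+2)/2`. -/
lemma cochainDiff_eq [CharZero k] {P : Operad k} [FiniteDimensional k (P.obj 2)]
    (A : PAlgebra P) (d : ℕ) (f : Cochains A d) :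
    cochainDiff A d f =
      (((d + 2 : ℕ) : k) / 2) • (coeffOperad A).deltaInv (structureElement A) d f := by
  have h1 := (coeffOperad A).coderComp_eq (by omega : 1 + 1 + (d + 1) = d + 2 + 1)
    (structureElement A) f
  have h2 := (coeffOperad A).coderComp_eq (by omega : d + 1 + 2 = d + 2 + 1)
    f (structureElement A)
  change (coeffOperad A).coderComp _ (structureElement A).1 f.1 -
    (-1 : k) ^ d • (coeffOperad A).coderComp _ f.1 (structureElement A).1 = _
  have h3 : ((d + 2).factorial : k) / ((d + 1).factorial * (1 + 1).factorial) =
      ((d + 2 : ℕ) : k) / 2 := by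
    have := factorial_cast_ne_zero (k := k) (d + 1)
    rw [Nat.factorial_succ (d + 1)]
    have h2 : (1 + 1).factorial = 2 := rfl
    rw [h2, Nat.cast_mul]
    push_cast
    field_simp
    ring
  have h4 : ((d + 2).factorial : k) / (Nat.factorial 2 * (d + 1).factorial) =
      ((d + 2 : ℕ) : k) / 2 := by
    rw [← h3, mul_comm]
  rw [h1, h2, h3, h4, Operad.deltaInv_apply, smul_sub, smul_comm ((-1 : k) ^ d)]

/-! ### The comparison map, its compatibility with differentials and its range. -/

/-- The family of cochains `(α ⊗ id)(t)`, suitably rescaled, for `t` in `(P ⊗ P^!)^Σ`. -/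
noncomputable def cochainFamily (P : Operad k) (d : ℕ) :
    HadamardInv P d →ₗ[k] ∀ A : PAlgebra P, Cochains A d :=
  LinearMap.pi fun A => (((d + 1).factorial : k) / 2 ^ d) •
    (hadamardHom A.action (OperadHom.id (quadDual P))).mapInv (d + 1)

lemma cochainFamily_apply (P : Operad k) (d : ℕ) (t : HadamardInv P d) (A : PAlgebra P) :
    cochainFamily P d t A = (((d + 1).factorial : k) / 2 ^ d) •
      (hadamardHom A.action (OperadHom.id (quadDual P))).mapInv (d + 1) t := rfl

/-- Since `α ⊗ id` is a morphism of operads and takes `χ` to `D`, it commutes with the brackets. The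
normalisation solves the recursion `c(d+1) = c(d) · (d+2)/2`, `c(0) = 1`, imposed by
`cochainDiff_eq`. -/
theorem familyDiff_cochainFamily [CharZero k] (P : Operad k) [FiniteDimensional k (P.obj 2)]
    (d : ℕ) (t : HadamardInv P d) :
    familyDiff P d (cochainFamily P d t) = cochainFamily P (d + 1) (deltaChi P d t) := by
  funext A
  change cochainDiff A d (cochainFamily P d t A) = _
  rw [cochainFamily_apply, map_smul, cochainDiff_eq, cochainFamily_apply, deltaChi,
    OperadHom.mapInv_deltaInv, structureElement_eq, smul_smul]
  congr 1
  rw [Nat.factorial_succ (d + 1), pow_succ]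
  push_cast
  field_simp
  ring

lemma DecTree.eval_comp {P Q S : Operad k} (g : OperadHom Q S) (f : OperadHom P Q) {n : ℕ}
    (T : DecTree P n) : T.eval (g.comp f) = g.map n (T.eval f) := by
  induction T with
  | edge => exact g.map_one.symm
  | corolla hn p => rfl
  | graft h i S T hS hT => simp only [DecTree.eval, hS, hT, g.map_comp]
  | relabel σ T hT => simp only [DecTree.eval, hT, g.map_act]

/-- Composing along `T` in `P` and then acting agrees with acting on the decorations and composing
in `End_A`; the whole family therefore comes from one element that does not depend on `A`. -/
lemma constantOperation_eq {P : Operad k} {d : ℕ} (T : DecTree P (d + 1))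
    (φ : (quadDual P).obj (d + 1)) (A : PAlgebra P) :
    constantOperation T φ A =
      (hadamardHom A.action (OperadHom.id (quadDual P))).mapInv (d + 1)
        ((hadamard P (quadDual P)).signAver (d + 1) (T.eval (OperadHom.id P) ⊗ₜ[k] φ)) := by
  refine Eq.trans ?_ (OperadHom.mapInv_signAver _ _).symm
  rw [constantOperation]
  have : T.eval A.action = A.action.map (d + 1) (T.eval (OperadHom.id P)) :=
    T.eval_comp A.action (OperadHom.id P)
  rw [this]
  rfl

/-- Vertices have arity at least two, so in arity one no corolla is available and the hypothesis on
`P(1)` is what reaches every operation. -/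
lemma exists_decTree {P : Operad k} (hP : ∀ p : P.obj 1, ∃ c : k, p = c • P.one) {d : ℕ}
    (p : P.obj (d + 1)) :
    ∃ (c : k) (T : DecTree P (d + 1)), p = c • T.eval (OperadHom.id P) := by
  obtain _ | d := d
  · obtain ⟨c, hc⟩ := hP p
    exact ⟨c, .edge, hc⟩
  · exact ⟨1, .corolla (by omega) p, (one_smul _ _).symm⟩

theorem range_cochainFamily [CharZero k] {P : Operad k}
    (hP : ∀ p : P.obj 1, ∃ c : k, p = c • P.one) (d : ℕ) :
    LinearMap.range (cochainFamily P d) = natConstants P d := by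
  have hc : ((d + 1).factorial : k) / 2 ^ d ≠ 0 :=
    div_ne_zero (factorial_cast_ne_zero _) (pow_ne_zero _ two_ne_zero)
  set av : P.obj (d + 1) ⊗[k] (quadDual P).obj (d + 1) →ₗ[k] HadamardInv P d :=
    (hadamard P (quadDual P)).signAver (d + 1) with hav
  have h1 : ∀ (T : DecTree P (d + 1)) (φ : (quadDual P).obj (d + 1)),
      cochainFamily P d (av (T.eval (OperadHom.id P) ⊗ₜ[k] φ)) =
        (((d + 1).factorial : k) / 2 ^ d) • constantOperation T φ := by
    intro T φ
    funext A
    rw [cochainFamily_apply, Pi.smul_apply, constantOperation_eq]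
    rfl
  apply le_antisymm
  · rintro _ ⟨t, rfl⟩
    -- An invariant is its own average. This permits an induction on tensors that are no longer
    -- required to be invariant.
    have ht : t = av t.1 := ((hadamard P (quadDual P)).signAver_coe t).symm
    rw [ht]
    generalize (t.1 : P.obj (d + 1) ⊗[k] (quadDual P).obj (d + 1)) = x
    induction x using TensorProduct.induction_on with
    | zero => rw [map_zero, map_zero]; exact Submodule.zero_mem _
    | add x y hx hy => rw [map_add, map_add]; exact Submodule.add_mem _ hx hy
    | tmul p φ =>
      obtain ⟨c, T, rfl⟩ := exists_decTree hP p
      rw [← TensorProduct.smul_tmul', map_smul, map_smul, h1]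
      exact Submodule.smul_mem _ _ (Submodule.smul_mem _ _ (Submodule.subset_span ⟨T, φ, rfl⟩))
  · refine Submodule.span_le.2 ?_
    rintro _ ⟨T, φ, rfl⟩
    refine ⟨(((d + 1).factorial : k) / 2 ^ d)⁻¹ • av (T.eval (OperadHom.id P) ⊗ₜ[k] φ), ?_⟩
    rw [map_smul, h1, smul_smul, inv_mul_cancel₀ hc, one_smul]

/-! ## Adjoining a constant to an operad -/

section Slots

variable {m n l : ℕ}

/-- The permutation of the inputs of `p ∘ᵢ b`, with `b` of arity `n + 1`, that moves the last
input of `b` to the last position. -/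
def moveLast (h : m + n = l + 1) (i : Fin m) : Perm (Fin (l + 1)) :=
  Fin.cycleIcc ⟨i.1 + n, by omega⟩ (Fin.last l)

lemma moveLast_val (h : m + n = l + 1) (i : Fin m) (x : Fin (l + 1)) :
    (moveLast h i x).1 = if x.1 = l then i.1 + n else if x.1 < i.1 + n then x.1 else x.1 + 1 := by
  have := x.2
  rw [moveLast]
  split_ifs with h1 h2
  · rw [show x = Fin.last l from Fin.ext h1, Fin.cycleIcc_of_last (Fin.le_last _)]
  · rw [Fin.cycleIcc_of_lt h2]
  · rw [Fin.cycleIcc_of_ge_of_lt (by simp [Fin.le_def]; omega) (by simp [Fin.lt_def]; omega),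
      Fin.val_add_one_of_lt (by simp [Fin.lt_def]; omega)]

/-- Together with `outerSlot_spec`, a disjunctive description of positions suited to `omega`, which
then verifies the identities between slots below. -/
lemma moveLast_spec (h : m + n = l + 1) (i : Fin m) (x : Fin (l + 1)) :
    (x.1 = l ∧ (moveLast h i x).1 = i.1 + n) ∨
      (x.1 < l ∧ x.1 < i.1 + n ∧ (moveLast h i x).1 = x.1) ∨
      (x.1 < l ∧ i.1 + n ≤ x.1 ∧ (moveLast h i x).1 = x.1 + 1) := by
  have := x.2
  rw [moveLast_val]
  split_ifs <;> omega

lemma outerSlot_spec (h : m + n = l + 1) (i a : Fin m) (ha : a ≠ i) :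
    (a.1 < i.1 ∧ (outerSlot h i a ha).1 = a.1) ∨
      (i.1 < a.1 ∧ (outerSlot h i a ha).1 + 1 = a.1 + n) := by
  have : a.1 ≠ i.1 := fun e => ha (Fin.ext e)
  simp only [outerSlot]
  split_ifs <;> omega

lemma moveLast_last (h : m + n = l + 1) (h' : m + (n + 1) = l + 1 + 1) (i : Fin m) :
    moveLast h i (Fin.last l) = innerSlot h' i (Fin.last n) := by
  ext; simp [moveLast_val, innerSlot]

lemma moveLast_inner (h : m + n = l + 1) (h' : m + (n + 1) = l + 1 + 1) (i : Fin m)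
    (j : Fin n) :
    moveLast h i (innerSlot h i j).castSucc = innerSlot h' i j.castSucc := by
  ext
  have := j.2
  simp only [moveLast_val, innerSlot, Fin.val_castSucc]
  split_ifs <;> omega

lemma moveLast_outer (h : m + n = l + 1) (h' : m + (n + 1) = l + 1 + 1) (i a : Fin m)
    (ha : a ≠ i) : moveLast h i (outerSlot h i a ha).castSucc = outerSlot h' i a ha := by
  ext
  have : a.1 ≠ i.1 := fun e => ha (Fin.ext e)
  have := a.2
  simp only [moveLast_val, outerSlot, Fin.val_castSucc]
  split_ifs <;> omega

lemma perm_ext_slots (h : m + n = l + 1) (i : Fin m) {ρ ρ' : Perm (Fin (l + 1))}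
    (h1 : ρ (Fin.last l) = ρ' (Fin.last l))
    (h2 : ∀ j, ρ (innerSlot h i j).castSucc = ρ' (innerSlot h i j).castSucc)
    (h3 : ∀ a (ha : a ≠ i),
      ρ (outerSlot h i a ha).castSucc = ρ' (outerSlot h i a ha).castSucc) : ρ = ρ' := by
  ext x : 1
  induction x using Fin.lastCases with
  | last => exact h1
  | cast x =>
    rcases slot_cases h i x with ⟨j, rfl⟩ | ⟨a, ha, rfl⟩
    · exact h2 j
    · exact h3 a ha

/-- The extension of a permutation that fixes the last element. -/
def extendLast (σ : Perm (Fin n)) : Perm (Fin (n + 1)) where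
  toFun := Fin.lastCases (Fin.last n) fun j => (σ j).castSucc
  invFun := Fin.lastCases (Fin.last n) fun j => (σ⁻¹ j).castSucc
  left_inv x := by
    induction x using Fin.lastCases with
    | last => simp
    | cast x => simp
  right_inv x := by
    induction x using Fin.lastCases with
    | last => simp
    | cast x => simp

@[simp]
lemma extendLast_last (σ : Perm (Fin n)) : extendLast σ (Fin.last n) = Fin.last n :=
  Fin.lastCases_last (motive := fun _ => Fin (n + 1))

@[simp]
lemma extendLast_castSucc (σ : Perm (Fin n)) (j : Fin n) :
    extendLast σ j.castSucc = (σ j).castSucc :=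
  Fin.lastCases_castSucc (motive := fun _ => Fin (n + 1)) j

lemma extendLast_one : extendLast (1 : Perm (Fin n)) = 1 := by
  ext x : 1
  induction x using Fin.lastCases <;> simp

lemma extendLast_mul (σ τ : Perm (Fin n)) :
    extendLast (σ * τ) = extendLast σ * extendLast τ := by
  ext x : 1
  induction x using Fin.lastCases <;> simp

lemma IsBlockPerm.extendLast_left {h : m + n = l + 1} {i : Fin m} {σ : Perm (Fin m)}
    {τ : Perm (Fin n)} {ρ : Perm (Fin l)} (H : IsBlockPerm h i σ τ ρ)
    (h' : m + 1 + n = l + 1 + 1) :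
    IsBlockPerm h' i.castSucc (extendLast σ) τ (extendLast ρ) := by
  constructor
  · intro j
    rw [extendLast_castSucc]
    have : innerSlot h' i.castSucc j = (innerSlot h i j).castSucc := rfl
    rw [this, extendLast_castSucc, H.inner]
    rfl
  · intro a ha
    induction a using Fin.lastCases with
    | last =>
      have e : ∀ (i : Fin m) (hi : Fin.last m ≠ i.castSucc),
          outerSlot h' i.castSucc (Fin.last m) hi = Fin.last l := by
        intro i hi
        have := i.2
        ext
        simp only [outerSlot, Fin.val_last, Fin.val_castSucc]
        split_ifs <;> omega
      rw [e, extendLast_last]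
      simp only [extendLast_castSucc, extendLast_last, e]
    | cast a =>
      have ha' : a ≠ i := fun e => ha (congrArg _ e)
      have : outerSlot h' i.castSucc a.castSucc ha = (outerSlot h i a ha').castSucc := rfl
      rw [this, extendLast_castSucc, H.outer]
      simp only [extendLast_castSucc]
      rfl

/-- The permutation identity behind equivariance in `P[x]` when the constant sits in the inner
operation: moving it to the end and then permuting the visible inputs agrees with permuting first,
the constant staying the last input of its block. -/
lemma IsBlockPerm.mul_moveLast {h : m + n = l + 1} {i : Fin m} {σ : Perm (Fin m)}
    {τ : Perm (Fin n)} {ρ : Perm (Fin l)} (H : IsBlockPerm h i σ τ ρ)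
    {h' : m + (n + 1) = l + 1 + 1} {ρ' : Perm (Fin (l + 1))}
    (H' : IsBlockPerm h' i σ (extendLast τ) ρ') :
    ρ' * moveLast h i = moveLast h (σ i) * extendLast ρ := by
  refine perm_ext_slots h i ?_ (fun j => ?_) fun a ha => ?_
  · rw [Equiv.Perm.mul_apply, Equiv.Perm.mul_apply, moveLast_last h h', extendLast_last,
      H'.inner, extendLast_last, moveLast_last h h']
  · rw [Equiv.Perm.mul_apply, Equiv.Perm.mul_apply, moveLast_inner h h', extendLast_castSucc,
      H'.inner, H.inner, extendLast_castSucc, moveLast_inner h h']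
  · rw [Equiv.Perm.mul_apply, Equiv.Perm.mul_apply, moveLast_outer h h', extendLast_castSucc,
      H'.outer, H.outer, moveLast_outer h h']

/-- Along with `moveLast_block_outer` and `IsBlockPerm.mul_moveLast_inner`, this supplies
associativity in `P[x]`: the constant can be moved to the end before or after a further insertion.
-/
lemma moveLast_block_inner {r s t : ℕ} (h₁ : m + n = l + 1)
    (h₂ : l + 1 + r = t + 1 + 1) (h₄ : m + s = t + 1) (i : Fin m)
    (j : Fin n) :
    IsBlockPerm h₂ (innerSlot h₁ i j).castSucc (moveLast h₁ i) (1 : Perm (Fin r))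
      (moveLast h₄ i) := by
  have := i.2
  have := j.2
  have e1 := moveLast_spec h₁ i (innerSlot h₁ i j).castSucc
  constructor
  · intro y
    have := y.2
    have e2 := moveLast_spec h₄ i (innerSlot h₂ (innerSlot h₁ i j).castSucc y)
    ext
    simp only [innerSlot, Fin.val_castSucc, Equiv.Perm.one_apply] at e1 e2 ⊢
    omega
  · intro y hy
    have := y.2
    have e2 := moveLast_spec h₁ i y
    have e3 := outerSlot_spec h₂ _ y hy
    have e4 := outerSlot_spec h₂ _ (moveLast h₁ i y) fun e => hy ((moveLast h₁ i).injective e)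
    have e5 := moveLast_spec h₄ i (outerSlot h₂ _ y hy)
    ext
    simp only [innerSlot, Fin.val_castSucc] at e1 e2 e3 e4 e5 ⊢
    omega

lemma moveLast_block_outer {r s t : ℕ} (h₁ : m + n = l + 1)
    (h₂ : l + 1 + r = t + 1 + 1) (h₃ : m + r = s + 1) (h₄ : s + n = t + 1) (i a : Fin m)
    (ha : a ≠ i) :
    IsBlockPerm h₂ (outerSlot h₁ i a ha).castSucc (moveLast h₁ i) (1 : Perm (Fin r))
      (moveLast h₄ (outerSlot h₃ a i ha.symm)) := by
  have := i.2
  have := a.2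
  have e0 := outerSlot_spec h₁ i a ha
  have e1 := moveLast_spec h₁ i (outerSlot h₁ i a ha).castSucc
  have e2 := outerSlot_spec h₃ a i ha.symm
  rw [Fin.val_castSucc] at e1
  constructor
  · intro y
    have := y.2
    have e3 := moveLast_spec h₄ (outerSlot h₃ a i ha.symm)
      (innerSlot h₂ (outerSlot h₁ i a ha).castSucc y)
    ext
    simp only [innerSlot, Fin.val_castSucc, Equiv.Perm.one_apply] at e3 ⊢
    omega
  · intro y hy
    have := y.2
    have e3 := moveLast_spec h₁ i y
    have e4 := outerSlot_spec h₂ _ y hy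
    have e5 := outerSlot_spec h₂ _ (moveLast h₁ i y) fun e => hy ((moveLast h₁ i).injective e)
    have e6 := moveLast_spec h₄ (outerSlot h₃ a i ha.symm) (outerSlot h₂ _ y hy)
    ext
    simp only [Fin.val_castSucc] at e4 e5
    omega

lemma IsBlockPerm.mul_moveLast_inner {r s t : ℕ} {h₁ : m + n = l + 1} {h₂ : l + r = t + 1}
    {h₃ : n + r = s + 1} {h₄ : m + s = t + 1} {h₄' : m + (s + 1) = t + 1 + 1} {i : Fin m}
    {j : Fin n} {ρ : Perm (Fin (t + 1))} (H : IsBlockPerm h₄' i 1 (moveLast h₃ j) ρ) :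
    ρ * moveLast h₄ i = moveLast h₂ (innerSlot h₁ i j) := by
  have := i.2
  have := j.2
  refine perm_ext_slots h₄ i ?_ (fun y => ?_) fun a ha => ?_
  · rw [Equiv.Perm.mul_apply, moveLast_last h₄ h₄', H.inner]
    ext
    simp only [moveLast_val, innerSlot, Fin.val_last, Equiv.Perm.one_apply]
    split_ifs <;> omega
  · have := y.2
    rw [Equiv.Perm.mul_apply, moveLast_inner h₄ h₄', H.inner]
    have e1 := moveLast_spec h₃ j y.castSucc
    have e2 := moveLast_spec h₂ (innerSlot h₁ i j) (innerSlot h₄ i y).castSucc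
    ext
    simp only [innerSlot, Fin.val_castSucc, Equiv.Perm.one_apply] at e1 e2 ⊢
    omega
  · have := a.2
    rw [Equiv.Perm.mul_apply, moveLast_outer h₄ h₄', H.outer]
    have e1 := outerSlot_spec h₄ i a ha
    have e2 := outerSlot_spec h₄' i a ha
    have e3 := moveLast_spec h₂ (innerSlot h₁ i j) (outerSlot h₄ i a ha).castSucc
    ext
    simp only [innerSlot, Fin.val_castSucc, Equiv.Perm.one_apply] at e3 ⊢
    omega

end Slots

variable (P : Operad k)

/-- The composition in `P[x]`, with `x` a constant such that `x² = 0`. -/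
def adjoinComp {m n l : ℕ} (h : m + n = l + 1) (i : Fin m) :
    (P.obj m × P.obj (m + 1)) →ₗ[k] (P.obj n × P.obj (n + 1)) →ₗ[k]
      (P.obj l × P.obj (l + 1)) :=
  LinearMap.mk₂ k
    -- A Leibniz rule: the constant comes from `p` or from `q`, and the term with both is discarded.
    -- If it comes from `p` it is still the last input after the insertion; if it comes from `q` it
    -- has to be moved there.
    (fun p q => (P.comp h i p.1 q.1,
      P.comp (by omega : m + 1 + n = l + 1 + 1) i.castSucc p.2 q.1 +
        P.act (moveLast h i) (P.comp (by omega : m + (n + 1) = l + 1 + 1) i p.1 q.2)))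
    (fun p p' q => by
      ext
      · simp
      · simp only [Prod.fst_add, Prod.snd_add, map_add, LinearMap.add_apply]; abel)
    (fun c p q => by
      ext
      · simp
      · simp)
    (fun p q q' => by
      ext
      · simp
      · simp only [Prod.fst_add, Prod.snd_add, map_add]; abel)
    (fun c p q => by
      ext
      · simp
      · simp)

lemma adjoinComp_apply {m n l : ℕ} (h : m + n = l + 1) (i : Fin m)
    (p : P.obj m × P.obj (m + 1)) (q : P.obj n × P.obj (n + 1)) :
    adjoinComp P h i p q = (P.comp h i p.1 q.1,
      P.comp (by omega : m + 1 + n = l + 1 + 1) i.castSucc p.2 q.1 +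
        P.act (moveLast h i) (P.comp (by omega : m + (n + 1) = l + 1 + 1) i p.1 q.2)) := rfl

lemma comp_act_moveLast_outer {m n r l s t : ℕ} (h₁ : m + n = l + 1)
    (h₁' : m + (n + 1) = l + 1 + 1) (h₂ : l + 1 + r = t + 1 + 1) (h₃ : m + r = s + 1)
    (h₄ : s + n = t + 1) (h₄' : s + (n + 1) = t + 1 + 1) (i a : Fin m) (ha : a ≠ i)
    (p : P.obj m) (q : P.obj (n + 1)) (x : P.obj r) :
    P.comp h₂ (outerSlot h₁ i a ha).castSucc (P.act (moveLast h₁ i) (P.comp h₁' i p q)) x =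
      P.act (moveLast h₄ (outerSlot h₃ a i ha.symm))
        (P.comp h₄' (outerSlot h₃ a i ha.symm) (P.comp h₃ a p x) q) := by
  rw [(moveLast_block_outer h₁ h₂ h₃ h₄ i a ha).comp_act_left P, moveLast_outer h₁ h₁',
    P.comp_comp_outer h₁' h₂ h₃ h₄' i a ha]

/-- The operad `P[x]` obtained from `P` by adjoining a constant `x` such that operations
that contain `x` twice vanish. An operation of `P[x]` of arity `n` is a pair of an operation of `P`
of arity `n` and of one of arity `n + 1` with `x` in the last input. -/
def adjoinConst : Operad k where
  obj n := P.obj n × P.obj (n + 1)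
  one := (P.one, 0)
  act σ := (P.act σ).prodMap (P.act (extendLast σ))
  comp h i := adjoinComp P h i
  act_one p := by
    ext
    · exact P.act_one _
    · change P.act (extendLast 1) _ = _
      rw [extendLast_one, P.act_one]
      rfl
  act_mul σ τ p := by
    ext
    · exact P.act_mul _ _ _
    · change P.act (extendLast _) _ = P.act _ (P.act _ _)
      rw [extendLast_mul, P.act_mul]
  one_comp {n} h q := by
    rw [adjoinComp_apply]
    ext
    · exact P.one_comp h _
    · have : moveLast h (0 : Fin 1) = 1 := by
        ext x
        have := x.2
        rw [moveLast_val, Equiv.Perm.one_apply]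
        simp only [Fin.val_zero]
        split_ifs <;> omega
      simp only [map_zero, LinearMap.zero_apply, zero_add, this, P.act_one]
      exact P.one_comp _ _
  comp_one h i p := by
    rw [adjoinComp_apply]
    ext
    · exact P.comp_one h i _
    · simp only [map_zero, add_zero]
      exact P.comp_one _ _ _
  comp_comp_inner {m n r l s t} h₁ h₂ h₃ h₄ i j p q x := by
    simp only [adjoinComp_apply]
    ext
    · exact P.comp_comp_inner h₁ h₂ h₃ h₄ i j _ _ _
    -- Three summands remain on each side, with the adjoined constant inside `p`, `q` or the
    -- innermost operation; they are compared in this order.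
    · simp only [map_add, LinearMap.add_apply, ← add_assoc]
      congr 1
      · congr 1
        · exact P.comp_comp_inner (by omega : m + 1 + n = l + 1 + 1)
            (by omega : l + 1 + r = t + 1 + 1) h₃ (by omega : m + 1 + s = t + 1 + 1)
            i.castSucc j _ _ _
        · rw [(moveLast_block_inner h₁ (by omega) h₄ i j).comp_act_left P,
            moveLast_inner h₁ (by omega),
            P.comp_comp_inner (by omega : m + (n + 1) = l + 1 + 1) (by omega)
              (by omega : n + 1 + r = s + 1 + 1) (by omega)]
      · obtain ⟨ρ, H, -⟩ := exists_isBlockPerm_right (by omega : m + (s + 1) = t + 1 + 1) i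
          (moveLast h₃ j)
        rw [H.comp_act_right P, ← P.act_mul, H.mul_moveLast_inner (h₁ := h₁) (h₂ := h₂),
          P.comp_comp_inner h₁ (by omega) (by omega : n + (r + 1) = s + 1 + 1) (by omega)]
  comp_comp_outer {m n r l s t} h₁ h₂ h₃ h₄ i a ha p q x := by
    simp only [adjoinComp_apply]
    ext
    · exact P.comp_comp_outer h₁ h₂ h₃ h₄ i a ha _ _ _
    · simp only [map_add, LinearMap.add_apply]
      rw [comp_act_moveLast_outer P h₁ _ _ h₃ h₄ (by omega),
        comp_act_moveLast_outer P h₃ _ _ h₁ h₂ (by omega)]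
      -- The summands with the constant in one of the two inserted operations appear in opposite
      -- orders on the two sides.
      refine (add_right_comm _ _ _).trans ?_
      congr 2
      exact P.comp_comp_outer (by omega : m + 1 + n = l + 1 + 1)
            (by omega : l + 1 + r = t + 1 + 1) (by omega : m + 1 + r = s + 1 + 1)
            (by omega : s + 1 + n = t + 1 + 1) i.castSucc a.castSucc
            (fun e => ha (Fin.castSucc_injective _ e)) _ _ _
  comp_act {m n l} h i σ τ ρ h1 h2 p q := by
    have H : IsBlockPerm h i σ τ ρ := ⟨h1, h2⟩
    simp only [adjoinComp_apply]
    ext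
    · exact H.comp_act P _ _
    · simp only [LinearMap.prodMap_apply, map_add]
      congr 1
      · rw [(H.extendLast_left (by omega)).comp_act P, extendLast_castSucc]
      · obtain ⟨ρ', H'⟩ := exists_isBlockPerm (by omega : m + (n + 1) = l + 1 + 1) i σ
          (extendLast τ)
        rw [H'.comp_act P, ← P.act_mul, ← P.act_mul, H.mul_moveLast H']

/-- The inclusion of `P` into `P[x]`. -/
def adjoinIncl : OperadHom P (adjoinConst P) where
  map n := LinearMap.inl k (P.obj n) (P.obj (n + 1))
  map_one := rfl
  map_act σ p := Prod.ext rfl (map_zero (P.act (extendLast σ))).symm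
  map_comp h i p q := by
    change _ = adjoinComp P h i (p, 0) (q, 0)
    rw [adjoinComp_apply]
    refine Prod.ext rfl ?_
    simp only [map_zero, LinearMap.zero_apply, add_zero]
    rfl

/-- The adjoined constant. -/
def adjoinedConst : (adjoinConst P).obj 0 := ((0, P.one) : P.obj 0 × P.obj 1)

/-- The reason for adjoining the constant: filling one input of `p` with it loses nothing, since `p`
survives as the second component. The constant is already last, so the permutation involved is
trivial. -/
lemma adjoinIncl_comp_adjoinedConst {n : ℕ} (p : P.obj (n + 1)) :
    (adjoinConst P).comp (rfl : n + 1 + 0 = n + 1) (Fin.last n)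
      ((adjoinIncl P).map (n + 1) p) (adjoinedConst P) = ((0, p) : P.obj n × P.obj (n + 1)) := by
  change adjoinComp P _ _ (p, 0) (0, P.one) = _
  rw [adjoinComp_apply]
  have : moveLast (rfl : n + 1 + 0 = n + 1) (Fin.last n) = 1 := by
    ext x
    have := x.2
    rw [moveLast_val, Equiv.Perm.one_apply]
    simp only [Fin.val_last]
    split_ifs <;> omega
  simp only [map_zero, zero_add, this, P.act_one]
  rw [P.comp_one]

/-! ## The algebra of constants of an operad -/

namespace Operad

variable (Q : Operad k)

/-- Substitution of constants into all inputs of an operation. -/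
def evalConst : ∀ {n : ℕ}, (Fin n → Q.obj 0) → Q.obj n →ₗ[k] Q.obj 0
  | 0, _ => LinearMap.id
  | n + 1, v => evalConst (fun j : Fin n => v j.castSucc) ∘ₗ
      (Q.comp (rfl : n + 1 + 0 = n + 1) (Fin.last n)).flip (v (Fin.last n))

lemma evalConst_succ {n : ℕ} (v : Fin (n + 1) → Q.obj 0) (p : Q.obj (n + 1)) :
    Q.evalConst v p = Q.evalConst (fun j => v j.castSucc)
      (Q.comp (rfl : n + 1 + 0 = n + 1) (Fin.last n) p (v (Fin.last n))) := rfl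

/-- Although `evalConst` fills inputs from the last to the first, any input may be filled first,
because insertions into different inputs commute. Equivariance, multilinearity and compatibility
with composition all rest on this freedom. -/
lemma evalConst_succAbove {n : ℕ} (v : Fin (n + 1) → Q.obj 0) (i : Fin (n + 1))
    (p : Q.obj (n + 1)) :
    Q.evalConst v p = Q.evalConst (fun j => v (i.succAbove j))
      (Q.comp (rfl : n + 1 + 0 = n + 1) i p (v i)) := by
  induction i using Fin.lastCases with
  | last => simp only [Fin.succAbove_last]; rfl
  | cast i =>
    induction n with
    | zero => exact i.elim0
    | succ n ih =>
      have hne : Fin.last (n + 1) ≠ i.castSucc := (Fin.castSucc_lt_last i).ne'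
      have e1 : outerSlot (rfl : n + 1 + 1 + 0 = n + 1 + 1) i.castSucc (Fin.last (n + 1)) hne =
          Fin.last n := by
        have := outerSlot_spec (rfl : n + 1 + 1 + 0 = n + 1 + 1) i.castSucc _ hne
        ext
        simp only [Fin.val_last, Fin.val_castSucc] at this ⊢
        omega
      have e2 : outerSlot (rfl : n + 1 + 1 + 0 = n + 1 + 1) (Fin.last (n + 1)) i.castSucc
          hne.symm = i := by
        have := i.2
        have := outerSlot_spec (rfl : n + 1 + 1 + 0 = n + 1 + 1) (Fin.last (n + 1)) _ hne.symm
        ext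
        simp only [Fin.val_last, Fin.val_castSucc] at this
        omega
      have e3 := Q.comp_comp_outer (rfl : n + 1 + 1 + 0 = n + 1 + 1)
        (rfl : n + 1 + 0 = n + 1) (rfl : n + 1 + 1 + 0 = n + 1 + 1)
        (rfl : n + 1 + 0 = n + 1) i.castSucc (Fin.last (n + 1)) hne p (v i.castSucc)
        (v (Fin.last (n + 1)))
      rw [e1, e2] at e3
      have e4 : Q.evalConst (fun j => v j.castSucc)
          (Q.comp (rfl : n + 1 + 1 + 0 = n + 1 + 1) (Fin.last (n + 1)) p
            (v (Fin.last (n + 1)))) = Q.evalConst (fun j => v (i.succAbove j).castSucc)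
          (Q.comp (rfl : n + 1 + 0 = n + 1) i (Q.comp (rfl : n + 1 + 1 + 0 = n + 1 + 1)
            (Fin.last (n + 1)) p (v (Fin.last (n + 1)))) (v i.castSucc)) := by
        induction i using Fin.lastCases with
        | last => simp only [Fin.succAbove_last]; rfl
        | cast i => exact ih _ _ i
      rw [evalConst_succ, e4, ← e3, evalConst_succ]
      have e5 : i.castSucc.succAbove (Fin.last n) = Fin.last (n + 1) := by
        simp
      simp only [Fin.castSucc_succAbove_castSucc, e5]

lemma succAbove_outerSlot {n : ℕ} (i a : Fin (n + 1)) (ha : a ≠ i) :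
    i.succAbove (outerSlot (rfl : n + 1 + 0 = n + 1) i a ha) = a := by
  have h := outerSlot_spec (rfl : n + 1 + 0 = n + 1) i a ha
  ext
  rcases h with ⟨h1, h2⟩ | ⟨h1, h2⟩
  · rw [Fin.succAbove_of_castSucc_lt _ _ (by simp [Fin.lt_def]; omega)]
    simpa using h2
  · rw [Fin.succAbove_of_le_castSucc _ _ (by simp [Fin.le_def]; omega)]
    simpa using h2

lemma evalConst_act {n : ℕ} (σ : Perm (Fin n)) (v : Fin n → Q.obj 0) (p : Q.obj n) :
    Q.evalConst v (Q.act σ p) = Q.evalConst (fun j => v (σ⁻¹ j)) p := by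
  induction n with
  | zero => rw [Subsingleton.elim σ 1, Q.act_one]; rfl
  | succ n ih =>
    obtain ⟨ρ, H⟩ := exists_isBlockPerm (rfl : n + 1 + 0 = n + 1) (Fin.last n) σ 1
    rw [evalConst_succ, H.comp_act_left Q, ih, Q.evalConst_succAbove _ (σ (Fin.last n)),
      perm_inv_apply]
    congr 2
    funext j
    obtain ⟨j, rfl⟩ := ρ.surjective j
    have hne : j.castSucc ≠ Fin.last n := (Fin.castSucc_lt_last j).ne
    have e1 : outerSlot (rfl : n + 1 + 0 = n + 1) (Fin.last n) j.castSucc hne = j := by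
      have := j.2
      have := outerSlot_spec (rfl : n + 1 + 0 = n + 1) (Fin.last n) _ hne
      ext
      simp only [Fin.val_last, Fin.val_castSucc] at this
      omega
    have e2 := H.outer _ hne
    rw [e1] at e2
    rw [perm_inv_apply, e2, succAbove_outerSlot, perm_inv_apply]

/-- Induction on the arity of `q`: its last input is filled first, which replaces `q` by an
operation of smaller arity. When `q` is itself a constant, inserting it is one step of the
evaluation of `p`. -/
lemma evalConst_comp {m n l : ℕ} (h : m + n = l + 1) (i : Fin m) (p : Q.obj m) (q : Q.obj n)
    (v : Fin l → Q.obj 0) :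
    Q.evalConst v (Q.comp h i p q) =
      Q.evalConst (plug h i (fun w => Q.evalConst w q) v) p := by
  induction n generalizing l with
  | zero =>
    have hm : m = l + 1 := h
    subst hm
    rw [Q.evalConst_succAbove (plug h i _ v) i, plug_self]
    congr 2
    funext j
    rw [plug_of_ne _ _ _ (Fin.succAbove_ne i j)]
    congr 1
    exact Fin.succAbove_right_injective (p := i) (succAbove_outerSlot i _ _).symm
  | succ n ih =>
    have hi := i.2
    obtain ⟨l, rfl⟩ : ∃ l', l = l' + 1 := ⟨l - 1, by omega⟩
    have h' : m + n = l + 1 := by omega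
    rw [Q.evalConst_succAbove v (innerSlot h i (Fin.last n)),
      Q.comp_comp_inner h (rfl : l + 1 + 0 = l + 1) (rfl : n + 1 + 0 = n + 1) h', ih h']
    congr 2
    have hs : ∀ y : Fin l, ((innerSlot h i (Fin.last n)).succAbove y).1 =
        if y.1 < i.1 + n then y.1 else y.1 + 1 := by
      intro y
      simp only [Fin.succAbove, Fin.lt_def, innerSlot, Fin.val_castSucc, Fin.val_last]
      split_ifs <;> rfl
    funext a
    by_cases ha : a = i
    · subst ha
      rw [plug_self, plug_self, evalConst_succ]
      congr 2
      funext j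
      congr 1
      ext
      rw [hs, if_pos (show (innerSlot h' a j).1 < a.1 + n from Nat.add_lt_add_left j.2 _)]
      rfl
    · rw [plug_of_ne _ _ _ ha, plug_of_ne _ _ _ ha]
      congr 1
      ext
      have h1 := outerSlot_spec h i a ha
      have h2 := outerSlot_spec h' i a ha
      rw [hs]
      split_ifs <;> omega

lemma evalConst_one (v : Fin 1 → Q.obj 0) : Q.evalConst v Q.one = v 0 := by
  rw [evalConst_succ]
  exact Q.one_comp _ _

lemma evalConst_update {n : ℕ} (v : Fin n → Q.obj 0) (i : Fin n) (p : Q.obj n) :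
    ∃ L : Q.obj 0 →ₗ[k] Q.obj 0, ∀ x, Q.evalConst (Function.update v i x) p = L x := by
  obtain _ | n := n
  · exact i.elim0
  refine ⟨Q.evalConst (fun j => v (i.succAbove j)) ∘ₗ
    Q.comp (rfl : n + 1 + 0 = n + 1) i p, fun x => ?_⟩
  rw [Q.evalConst_succAbove _ i]
  simp

/-- The operation on constants given by an element of the operad. -/
def constMultilinear {n : ℕ} (p : Q.obj n) :
    MultilinearMap k (fun _ : Fin n => Q.obj 0) (Q.obj 0) where
  toFun v := Q.evalConst v p
  map_update_add' {dec} v i x y := by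
    rw [Subsingleton.elim dec (instDecidableEqFin n)]
    obtain ⟨L, hL⟩ := Q.evalConst_update v i p
    rw [hL, hL, hL, map_add]
  map_update_smul' {dec} v i c x := by
    rw [Subsingleton.elim dec (instDecidableEqFin n)]
    obtain ⟨L, hL⟩ := Q.evalConst_update v i p
    rw [hL, hL, map_smul]

/-- The constants of an operad form an algebra over it. -/
def constAlgebra : PAlgebra Q where
  carrier := Q.obj 0
  action :=
    { map := fun _ =>
        { toFun := Q.constMultilinear
          map_add' := fun p q => MultilinearMap.ext fun v => map_add (Q.evalConst v) p q
          map_smul' := fun c p => MultilinearMap.ext fun v => map_smul (Q.evalConst v) c p }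
      map_one := MultilinearMap.ext fun v => Q.evalConst_one v
      map_act := fun σ p => MultilinearMap.ext fun v => Q.evalConst_act σ v p
      map_comp := fun h i p q => MultilinearMap.ext fun v => Q.evalConst_comp h i p q v }

end Operad

/-! ### Faithful algebras and injectivity of the comparison map. -/

/-- Every operad maps to one that has enough constants to separate the operations of a given
arity. -/
theorem exists_separating_constants (n : ℕ) (P : Operad k) :
    ∃ (Q : Operad k) (f : OperadHom P Q) (a : Fin n → Q.obj 0),
      Function.Injective fun p : P.obj n => Q.evalConst a (f.map n p) := by
  induction n generalizing P with
  | zero => exact ⟨P, OperadHom.id P, Fin.elim0, fun p q h => h⟩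
  | succ n ih =>
    -- The induction hypothesis is applied to `P[x]`, not to `P`: filling the last input with `x`
    -- embeds `P(n+1)` into `P[x](n)`, where `n` constants already separate.
    obtain ⟨Q, f, a, hf⟩ := ih (adjoinConst P)
    refine ⟨Q, f.comp (adjoinIncl P), Fin.snoc a (f.map 0 (adjoinedConst P)), ?_⟩
    intro p q hpq
    have key : ∀ p : P.obj (n + 1),
        Q.evalConst (Fin.snoc a (f.map 0 (adjoinedConst P)))
          ((f.comp (adjoinIncl P)).map (n + 1) p) =
        Q.evalConst a (f.map n ((0, p) : P.obj n × P.obj (n + 1))) := by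
      intro p
      rw [← adjoinIncl_comp_adjoinedConst, f.map_comp, Operad.evalConst_succ]
      simp only [Fin.snoc_castSucc, Fin.snoc_last]
      rfl
    simp only [key] at hpq
    exact congrArg Prod.snd (hf hpq)

/-- The constants of `Q` form a `Q`-algebra, hence a `P`-algebra by restriction, and evaluation at
the single tuple of separating constants already distinguishes the operations. -/
theorem exists_faithful_algebra (n : ℕ) (P : Operad k) :
    ∃ A : PAlgebra P, Function.Injective (A.action.map n) := by
  obtain ⟨Q, f, a, hf⟩ := exists_separating_constants n P
  refine ⟨Q.constAlgebra.pullback f, fun p q hpq => hf ?_⟩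
  exact congrArg
    (fun g : MultilinearMap k (fun _ : Fin n => Q.obj 0) (Q.obj 0) => g a) hpq

/-- It suffices to test a family on one algebra, faithful in arity `d + 1`. The map `α ⊗ id` stays
injective because vector spaces are flat, and the scalar is nonzero in characteristic zero. -/
theorem cochainFamily_injective [CharZero k] (P : Operad k) (d : ℕ) :
    Function.Injective (cochainFamily P d) := by
  rw [injective_iff_map_eq_zero]
  intro t ht
  obtain ⟨A, hA⟩ := exists_faithful_algebra (d + 1) P
  have h := congrFun ht A
  rw [cochainFamily_apply, Pi.zero_apply, smul_eq_zero] at h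
  have hc : ((d + 1).factorial : k) / 2 ^ d ≠ 0 :=
    div_ne_zero (factorial_cast_ne_zero _) (pow_ne_zero _ two_ne_zero)
  have h1 := congrArg Subtype.val (h.resolve_left hc)
  have h2 : Function.Injective (LinearMap.rTensor ((quadDual P).obj (d + 1))
      (A.action.map (d + 1))) :=
    Module.Flat.rTensor_preserves_injective_linearMap _ hA
  exact Subtype.ext (h2 (h1.trans (map_zero (LinearMap.rTensor _ (A.action.map (d + 1)))).symm))

/-! ## Quadratic operads -/

/-- The operations of arity zero and one that can be written without generators. -/
def lowArity (P : Operad k) : ∀ n, Submodule k (P.obj n)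
  | 0 => ⊥
  | 1 => Submodule.span k {P.one}
  | _ + 2 => ⊤

/-- The vanishing in arity zero has to be carried along: otherwise inserting a constant into a
binary operation could produce new unary operations. -/
lemma comp_mem_lowArity (P : Operad k) {m n l : ℕ} (h : m + n = l + 1) (i : Fin m)
    {p : P.obj m} {q : P.obj n} (hp : p ∈ lowArity P m) (hq : q ∈ lowArity P n) :
    P.comp h i p q ∈ lowArity P l := by
  match l with
  | _ + 2 => exact Submodule.mem_top
  | 0 =>
    obtain rfl : n = 0 := by have := i.2; omega
    rw [(Submodule.mem_bot k).1 hq, map_zero]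
    exact Submodule.zero_mem _
  | 1 =>
    match n with
    | 0 =>
      rw [(Submodule.mem_bot k).1 hq, map_zero]
      exact Submodule.zero_mem _
    | 1 =>
      obtain rfl : m = 1 := by omega
      obtain ⟨c, rfl⟩ := Submodule.mem_span_singleton.1 hp
      rw [map_smul, LinearMap.smul_apply, Subsingleton.elim i 0, P.one_comp]
      exact Submodule.smul_mem _ _ hq
    | n + 2 => have := i.2; omega

lemma mk_mem_lowArity (E : SigmaTwoModule k) {n : ℕ} (t : Term E n) :
    (FreeObj.mk t : (freeOperad E).obj n) ∈ lowArity (freeOperad E) n := by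
  induction t with
  | zero n => exact Submodule.zero_mem _
  | add s t hs ht => exact Submodule.add_mem _ hs ht
  | smul c t ht => exact Submodule.smul_mem _ c ht
  | one => exact Submodule.mem_span_singleton_self (freeOperad E).one
  | gen e => exact Submodule.mem_top (x := freeGen E e)
  | @act n σ t ht =>
    have key : ∀ (n : ℕ) (σ : Perm (Fin n)) (x : (freeOperad E).obj n),
        x ∈ lowArity (freeOperad E) n → (freeOperad E).act σ x ∈ lowArity (freeOperad E) n := by
      intro n σ x hx
      match n with
      | 0 => rwa [Subsingleton.elim σ 1, Operad.act_one]
      | 1 => rwa [Subsingleton.elim σ 1, Operad.act_one]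
      | _ + 2 => exact Submodule.mem_top
    exact key n σ _ ht
  | comp h i s t hs ht => exact comp_mem_lowArity _ h i hs ht

/-- Expressions built from binary generators and the unit have no constants and, in arity one, only
multiples of the unit; quotients and isomorphisms preserve this. -/
lemma Operad.IsQuadratic.eq_smul_one {P : Operad k} (hP : P.IsQuadratic) (p : P.obj 1) :
    ∃ c : k, p = c • P.one := by
  obtain ⟨E, R, ⟨f⟩⟩ := hP
  obtain ⟨x, hx⟩ := Submodule.Quotient.mk_surjective _ (f.inv.map 1 p)
  have h1 : x ∈ lowArity (freeOperad E) 1 := by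
    induction x using FreeObj.ind with
    | h t => exact mk_mem_lowArity E t
  obtain ⟨c, rfl⟩ := Submodule.mem_span_singleton.1 h1
  refine ⟨c, ?_⟩
  rw [← f.hom_inv 1 p, ← hx]
  refine (map_smul (f.hom.map 1) c (Submodule.Quotient.mk (freeOperad E).one)).trans ?_
  congr 1
  exact f.hom.map_one

/-! ## The universal property of the quadratic dual -/

section Lift

variable {E : SigmaTwoModule k} {Q : Operad k}

/-- The value in an operad of a formal expression in the generators. -/
def Term.eval (g : E.carrier →ₗ[k] Q.obj 2) : ∀ {n : ℕ}, Term E n → Q.obj n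
  | _, .zero _ => 0
  | _, .add s t => s.eval g + t.eval g
  | _, .smul c t => c • t.eval g
  | _, .one => Q.one
  | _, .gen e => g e
  | _, .act σ t => Q.act σ (t.eval g)
  | _, .comp h i s t => Q.comp h i (s.eval g) (t.eval g)

lemma Term.eval_eq_of_rel (g : E.carrier →ₗ[k] Q.obj 2)
    (hg : ∀ e, g (E.tau e) = Q.act (Equiv.swap 0 1) (g e)) {n : ℕ} {s t : Term E n}
    (h : TermRel E s t) : s.eval g = t.eval g := by
  induction h with
  | refl => rfl
  | symm _ h => exact h.symm
  | trans _ _ h h' => exact h.trans h'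
  | add_congr _ _ h h' => simp only [Term.eval, h, h']
  | smul_congr _ _ h => simp only [Term.eval, h]
  | act_congr _ _ h => simp only [Term.eval, h]
  | comp_congr _ _ _ _ h h' => simp only [Term.eval, h, h']
  | add_assoc => exact add_assoc _ _ _
  | add_comm => exact add_comm _ _
  | zero_add => exact zero_add _
  | neg_add => simp only [Term.eval, neg_smul, one_smul, neg_add_cancel]
  | smul_add => exact smul_add _ _ _
  | add_smul => exact add_smul _ _ _
  | mul_smul => exact mul_smul _ _ _
  | one_smul => exact one_smul _ _
  | gen_add => exact map_add g _ _
  | gen_smul => exact map_smul g _ _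
  | gen_tau => exact hg _
  | act_add => exact map_add _ _ _
  | act_smul => exact map_smul _ _ _
  | comp_add_left => simp only [Term.eval, map_add, LinearMap.add_apply]
  | comp_add_right => simp only [Term.eval, map_add]
  | comp_smul_left => simp only [Term.eval, map_smul, LinearMap.smul_apply]
  | comp_smul_right => simp only [Term.eval, map_smul]
  | act_one => exact Q.act_one _
  | act_mul => exact Q.act_mul _ _ _
  | one_comp h => exact Q.one_comp h _
  | comp_one h i => exact Q.comp_one h i _
  | comp_comp_inner h₁ h₂ h₃ h₄ i j => exact Q.comp_comp_inner h₁ h₂ h₃ h₄ i j _ _ _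
  | comp_comp_outer h₁ h₂ h₃ h₄ i a ha => exact Q.comp_comp_outer h₁ h₂ h₃ h₄ i a ha _ _ _
  | comp_act h i σ τ ρ h₁ h₂ => exact Q.comp_act h i σ τ ρ h₁ h₂ _ _

/-- The morphism from the free operad that extends an equivariant map of generators. -/
def freeLift (g : E.carrier →ₗ[k] Q.obj 2)
    (hg : ∀ e, g (E.tau e) = Q.act (Equiv.swap 0 1) (g e)) : OperadHom (freeOperad E) Q where
  map n :=
    { toFun := Quotient.lift (fun t : Term E n => t.eval g) fun _ _ h => Term.eval_eq_of_rel g hg h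
      map_add' := fun x y => by
        induction x using FreeObj.ind; induction y using FreeObj.ind; rfl
      map_smul' := fun c x => by
        induction x using FreeObj.ind; rfl }
  map_one := rfl
  map_act σ p := by
    induction p using FreeObj.ind; rfl
  map_comp h i p q := by
    induction p using FreeObj.ind; induction q using FreeObj.ind; rfl

end Lift

/-- The kernel of a morphism of operads. -/
def OperadHom.ker {P Q : Operad k} (f : OperadHom P Q) : OperadIdeal P where
  carrier n := LinearMap.ker (f.map n)
  act_mem σ p hp := by
    rw [LinearMap.mem_ker] at hp ⊢
    rw [f.map_act, hp, map_zero]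
  comp_mem_left h i p q hp := by
    rw [LinearMap.mem_ker] at hp ⊢
    rw [f.map_comp, hp, map_zero, LinearMap.zero_apply]
  comp_mem_right h i p q hq := by
    rw [LinearMap.mem_ker] at hq ⊢
    rw [f.map_comp, hq, map_zero]

/-- The morphism induced on the quotient by an ideal that is contained in the kernel. -/
def quotientLift {P Q : Operad k} (I : OperadIdeal P) (f : OperadHom P Q)
    (hI : ∀ n, I.carrier n ≤ LinearMap.ker (f.map n)) : OperadHom (quotientOperad P I) Q where
  map n := (I.carrier n).liftQ (f.map n) (hI n)
  map_one := f.map_one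
  map_act σ p := by
    obtain ⟨p, rfl⟩ := Submodule.Quotient.mk_surjective _ p
    exact f.map_act σ p
  map_comp h i p q := by
    obtain ⟨p, rfl⟩ := Submodule.Quotient.mk_surjective _ p
    obtain ⟨q, rfl⟩ := Submodule.Quotient.mk_surjective _ q
    exact f.map_comp h i p q

lemma idealSpan_le {P : Operad k} {R : Set (P.obj 3)} (I : OperadIdeal P)
    (hI : R ⊆ I.carrier 3) (n : ℕ) : (idealSpan P R).carrier n ≤ I.carrier n :=
  iInf_le (fun I : {I : OperadIdeal P // R ⊆ I.carrier 3} => I.1.carrier n) ⟨I, hI⟩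

lemma cubicMap_comp {V W : Type u} [AddCommGroup V] [Module k V] [AddCommGroup W] [Module k W]
    (Q : Operad k) (g : W →ₗ[k] Q.obj 2) (e : V →ₗ[k] W) (ξ : Fin 3 → V ⊗[k] V) :
    cubicMap Q (g ∘ₗ e) ξ = cubicMap Q g fun j => TensorProduct.map e e (ξ j) := by
  simp only [cubicMap, LinearMap.sum_apply, LinearMap.comp_apply, LinearMap.proj_apply,
    TensorProduct.map_comp]

lemma dualDistrib_map_dualMap {V W : Type u} [AddCommGroup V] [Module k V] [AddCommGroup W]
    [Module k W] (e : W →ₗ[k] V) (x : Module.Dual k V ⊗[k] Module.Dual k V) (y : W ⊗[k] W) :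
    TensorProduct.dualDistrib k W W (TensorProduct.map e.dualMap e.dualMap x) y =
      TensorProduct.dualDistrib k V V x (TensorProduct.map e e y) := by
  induction x using TensorProduct.induction_on with
  | zero => simp
  | add x x' h h' => simp only [map_add, LinearMap.add_apply, h, h']
  | tmul a b =>
    induction y using TensorProduct.induction_on with
    | zero => simp
    | add y y' h h' => simp only [map_add, h, h']
    | tmul c d => simp

/-- A morphism carries the relations of `Q` into those of `P`, because `cubicMap` commutes with it.
By adjointness of the pairing, its transpose then carries annihilators in the opposite direction. -/
lemma map_dualMap_mem_dualRelations {P Q : Operad k} (f : OperadHom Q P)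
    {ξ : Fin 3 → Module.Dual k (P.obj 2) ⊗[k] Module.Dual k (P.obj 2)}
    (hξ : ξ ∈ dualRelations P) :
    (fun j => TensorProduct.map (f.map 2).dualMap (f.map 2).dualMap (ξ j)) ∈
      dualRelations Q := by
  intro r hr
  simp only [dualDistrib_map_dualMap]
  refine hξ (fun j => TensorProduct.map (f.map 2) (f.map 2) (r j)) ?_
  rw [quadRelations, LinearMap.mem_ker] at hr ⊢
  rw [← cubicMap_comp, LinearMap.id_comp]
  have := cubicMap_map f LinearMap.id r
  rw [hr, map_zero, LinearMap.comp_id] at this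
  exact this.symm

/-- The morphism of quadratic duals that is contragredient to a morphism of operads. -/
theorem exists_quadDual_hom {P Q : Operad k} (f : OperadHom Q P) :
    ∃ F : OperadHom (quadDual P) (quadDual Q),
      ∀ ξ : Module.Dual k (P.obj 2), F.map 2 (dualGen P ξ) = dualGen Q (ξ ∘ₗ f.map 2) := by
  let g : Module.Dual k (P.obj 2) →ₗ[k] (quadDual Q).obj 2 := dualGen Q ∘ₗ (f.map 2).dualMap
  have hg : ∀ ξ, g ((dualGenerators P).tau ξ) = (quadDual Q).act (Equiv.swap 0 1) (g ξ) := by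
    intro ξ
    change dualGen Q ((f.map 2).dualMap (-((P.act (Equiv.swap 0 1)).dualMap ξ))) =
      (quadDual Q).act (Equiv.swap 0 1) (dualGen Q ((f.map 2).dualMap ξ))
    rw [dualGen_swap, map_neg, map_neg]
    congr 2
    ext q
    exact congrArg (fun p => (show Module.Dual k (P.obj 2) from ξ) p) (f.map_act _ q).symm
  let G : OperadHom (freeOperad (dualGenerators P)) (quadDual Q) := freeLift g hg
  have hG : ∀ n, (dualIdeal P).carrier n ≤ LinearMap.ker (G.map n) := by
    intro n
    -- The kernel of `G` is an operadic ideal, so only the arity three generators of `(R^⊥)` have to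
    -- be tested.
    refine idealSpan_le G.ker ?_ n
    rintro _ ⟨ξ, hξ, rfl⟩
    change G.map 3 (cubicMap _ (dualFreeGen P) ξ) = 0
    rw [cubicMap_map]
    change cubicMap (quadDual Q) (dualGen Q ∘ₗ (f.map 2).dualMap) ξ = 0
    rw [cubicMap_comp]
    exact cubicMap_quadDual Q _ (map_dualMap_mem_dualRelations f hξ)
  exact ⟨quotientLift _ G hG, fun ξ => rfl⟩

/-! ## The isomorphism of complexes -/

/-- The identification of the natural operations without inputs with `(P ⊗ P^!)^Σ`. -/
noncomputable def natConstantsEquiv [CharZero k] (P : Operad k) (hP : P.IsQuadratic) (d : ℕ) :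
    natConstants P d ≃ₗ[k] HadamardInv P d :=
  ((LinearEquiv.ofInjective _ (cochainFamily_injective P d)).trans
    (LinearEquiv.ofEq _ _ (range_cochainFamily hP.eq_smul_one d))).symm

lemma coe_natConstantsEquiv_symm [CharZero k] (P : Operad k) (hP : P.IsQuadratic) (d : ℕ)
    (t : HadamardInv P d) :
    ((natConstantsEquiv P hP d).symm t).1 = cochainFamily P d t := rfl

lemma coe_eq_cochainFamily [CharZero k] (P : Operad k) (hP : P.IsQuadratic) (d : ℕ)
    (U : natConstants P d) : U.1 = cochainFamily P d (natConstantsEquiv P hP d U) := by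
  rw [← coe_natConstantsEquiv_symm P hP, LinearEquiv.symm_apply_apply]

lemma natConstantsEquiv_eq [CharZero k] (P : Operad k) (hP : P.IsQuadratic) (d : ℕ)
    (U : natConstants P d) (t : HadamardInv P d) (h : U.1 = cochainFamily P d t) :
    natConstantsEquiv P hP d U = t := by
  rw [← LinearEquiv.eq_symm_apply]
  exact Subtype.ext h

lemma deltaChi_deltaChi [CharZero k] (P : Operad k) [FiniteDimensional k (P.obj 2)] (d : ℕ)
    (t : HadamardInv P d) : deltaChi P (d + 1) (deltaChi P d t) = 0 :=
  (hadamard P (quadDual P)).deltaInv_deltaInv _ (preLieInv_canonicalElement P) d t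

lemma mem_natConstants_iff [CharZero k] {P : Operad k} (hP : P.IsQuadratic) {d : ℕ}
    {U : ∀ A : PAlgebra P, Cochains A d} :
    U ∈ natConstants P d ↔ ∃ t, cochainFamily P d t = U := by
  rw [← range_cochainFamily hP.eq_smul_one, LinearMap.mem_range]

lemma hadamardHom_map_comp {P P' P'' Q Q' Q'' : Operad k} (f : OperadHom P P')
    (f' : OperadHom P' P'') (g : OperadHom Q Q') (g' : OperadHom Q' Q'') {n : ℕ}
    (t : (hadamard P Q).obj n) :
    (hadamardHom f' g').map n ((hadamardHom f g).map n t) =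
      (hadamardHom (f'.comp f) (g'.comp g)).map n t :=
  LinearMap.congr_fun (TensorProduct.map_comp (f'.map n) (g'.map n) (f.map n) (g.map n)).symm t

end NatOp

/-! ### Assembly of the proposition. -/

theorem mainTheorem2 {k : Type u} [Field k] [CharZero k] :
    -- both sides are cochain complexes
    (∀ (P : NatOp.Operad k) [FiniteDimensional k (P.obj 2)], P.IsQuadratic →
      (hadamard P (quadDual P)).bracketInv (rfl : 2 + 2 = 3 + 1) (canonicalElement P)
        (canonicalElement P) = 0 ∧
      ∀ d t, deltaChi P (d + 1) (deltaChi P d t) = 0) ∧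
    ∃ hδ : ∀ (P : NatOp.Operad k) [FiniteDimensional k (P.obj 2)], P.IsQuadratic →
        ∀ d, ∀ U ∈ natConstants P d, familyDiff P d U ∈ natConstants P (d + 1),
    (∀ (P : NatOp.Operad k) [FiniteDimensional k (P.obj 2)], P.IsQuadratic →
      ∀ d, ∀ U ∈ natConstants P d, familyDiff P (d + 1) (familyDiff P d U) = 0) ∧
    ∃ Φ : ∀ (P : NatOp.Operad k) [FiniteDimensional k (P.obj 2)], P.IsQuadratic →
        ∀ d, natConstants P d ≃ₗ[k] HadamardInv P d,
      -- the isomorphism commutes with the differentials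
      (∀ (P : NatOp.Operad k) [FiniteDimensional k (P.obj 2)] (hP : P.IsQuadratic) (d : ℕ)
        (U : natConstants P d),
        Φ P hP (d + 1) ((familyDiff P d).restrict (hδ P hP d) U) =
          deltaChi P d (Φ P hP d U)) ∧
      -- up to a scalar, its inverse is the action on cochains induced by `α : P → End_A`
      (∀ (P : NatOp.Operad k) [FiniteDimensional k (P.obj 2)] (hP : P.IsQuadratic) (d : ℕ)
        (t : HadamardInv P d) (A : PAlgebra P),
        ((Φ P hP d).symm t).1 A = (((d + 1).factorial : k) / 2 ^ d) •
          (hadamardHom A.action (OperadHom.id (quadDual P))).mapInv (d + 1) t) ∧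
      -- it is natural with respect to isomorphisms of operads
      (∀ (P Q : NatOp.Operad k) [FiniteDimensional k (P.obj 2)]
        [FiniteDimensional k (Q.obj 2)] (hP : P.IsQuadratic) (hQ : Q.IsQuadratic)
        (f : OperadIso P Q),
        ∃ F : OperadHom (quadDual P) (quadDual Q),
          (∀ ξ : Module.Dual k (P.obj 2),
            F.map 2 (dualGen P ξ) = dualGen Q (ξ ∘ₗ f.inv.map 2)) ∧
          ∀ (d : ℕ) (U : natConstants P d), ∃ V : natConstants Q d,
            (∀ A : PAlgebra Q, (V.1 A).1 =
              (hadamardHom (OperadHom.id (endOperad k A.carrier)) F).map (d + 1)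
                (U.1 (A.pullback f.hom)).1) ∧
            Φ Q hQ d V = (hadamardHom f.hom F).mapInv (d + 1) (Φ P hP d U)) := by
  refine ⟨fun P _ hP => ⟨bracketInv_canonicalElement P, deltaChi_deltaChi P⟩, ?_, ?_,
    fun P _ hP d => natConstantsEquiv P hP d, ?_, ?_, ?_⟩
  · intro P _ hP d U hU
    obtain ⟨t, rfl⟩ := (mem_natConstants_iff hP).1 hU
    rw [familyDiff_cochainFamily]
    exact (mem_natConstants_iff hP).2 ⟨_, rfl⟩
  · intro P _ hP d U hU
    obtain ⟨t, rfl⟩ := (mem_natConstants_iff hP).1 hU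
    rw [familyDiff_cochainFamily, familyDiff_cochainFamily, deltaChi_deltaChi, map_zero]
  · intro P _ hP d U
    apply natConstantsEquiv_eq
    rw [← familyDiff_cochainFamily, ← coe_eq_cochainFamily]
    rfl
  · intro P _ hP d t A
    rfl
  · intro P Q _ _ hP hQ f
    -- The quadratic dual is contravariant, so a morphism from `P^!` to `Q^!` is obtained from the
    -- inverse of `f`.
    obtain ⟨F, hF⟩ := exists_quadDual_hom f.inv
    refine ⟨F, hF, fun d U => ?_⟩
    set t := natConstantsEquiv P hP d U
    refine ⟨(natConstantsEquiv Q hQ d).symm ((hadamardHom f.hom F).mapInv (d + 1) t),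
      fun A => ?_, LinearEquiv.apply_symm_apply _ _⟩
    rw [coe_natConstantsEquiv_symm, coe_eq_cochainFamily P hP d U, cochainFamily_apply,
      cochainFamily_apply, Submodule.coe_smul, Submodule.coe_smul, map_smul]
    simp only [OperadHom.coe_mapInv]
    congr 1
    -- Both sides are `(α ∘ f) ⊗ F` applied to `t`: on the left `f ⊗ F` acts first and then `α ⊗
    -- id`, on the right `(α ∘ f) ⊗ id` and then `id ⊗ F`.
    exact (hadamardHom_map_comp f.hom A.action F (OperadHom.id (quadDual Q)) t.1).trans
      (hadamardHom_map_comp (A.action.comp f.hom) (OperadHom.id (endOperad k A.carrier))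
        (OperadHom.id (quadDual P)) F t.1).symm
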